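/- Let $\mathcal X$ be a finite alphabet and let $P_1,P_2$ be probability distributions on $\mathcal X$ with full support. Write $D(\cdot\|\cdot)$ for the Kullback--Leibler divergence (natural logarithm), $\mathrm{GJS}(P,Q,\alpha)=\alpha D\big(P\,\big\|\,\tfrac{\alpha P+Q}{1+\alpha}\big)+D\big(Q\,\big\|\,\tfrac{\alpha P+Q}{1+\alpha}\big)$ for $\alpha>0$, and $C(P,Q)=-\min_{\eta\in[0,1]}\log\sum_x P(x)^\eta Q(x)^{1-\eta}$. Two training sequences $X_1^N\sim P_1^N$, $X_2^N\sim P_2^N$ and a stream $Y_1,Y_2,\dots$ of test samples, i.i.d. with law $P_i$ under hypothesis $H_i$ $(i=1,2)$, are observed, all samples being independent; $\mathsf T_{x}$ denotes the empirical distribution of a finite sequence $x$. A test is a pair $(T,d)$ of a stopping time $T$ of the filtration $\sigma(X_1^N,X_2^N,Y_1,\dots,Y_n)$ and a decision $d\in\{H_1,H_2\}$ based on the data up to time $T$. For a prior $(\pi_1,\pi_2)$ with $\pi_1\in(0,1)$, $\pi_2=1-\pi_1$, the Bayesian error exponent of a family of tests $\Phi=(\Phi_N)_N$ is $\mathsf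 e(\Phi)=\liminf_{N\to\infty}-\frac1N\log\big(\pi_1\mathrm P_1(d\ne H_1)+\pi_2\mathrm P_2(d\neq H_2)\big)$. Sequential test $\Phi_{\mathrm{seq}}(\gamma)$: with $S_i(n)=n\,\mathrm{GJS}(\mathsf T_{X_i^N},\mathsf T_{Y^n},N/n)$, stop at $T=\min\big(\inf\{n\ge1: S_1(n)\ge\gamma N\text{ or }S_2(n)\ge\gamma N\},\,N^2\big)$ and decide $H_1$ if only $S_2(T)\ge\gamma N$, $H_2$ if only $S_1(T)\ge\gamma N$ (and arbitrarily if both or neither hold). Gutman's test $\Phi_{\mathrm{GUT}}(\lambda,\alpha)$ with $n$ test samples: decide $H_1$ if $\mathrm{GJS}(\mathsf T_{X_1^N},\mathsf T_{Y^n},\alpha)<\lambda\alpha$, $H_2$ if it is $>\lambda\alpha$ (and arbitrarily in case of equality). Put $$F_1(\alpha,\lambda)=\min\Big\{D(Q_1\|P_1)+\tfrac1\alpha D(Q_2\|P_2)\ :\ \tfrac1\alpha\mathrm{GJS}(Q_1,Q_2,\alpha)\le\lambda\Big\},$$ the minimum being over pairs of probability distributions on $\mathcal X$. **Theorem.** Let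 $\gamma\in(0,C(P_1,P_2)]$, let $\beta^\star_\gamma>0$ and $\theta^\star_\gamma>0$ be the solutions of $\mathrm{GJS}(P_2,P_1,\beta^\star_\gamma)=\gamma\beta^\star_\gamma$ and $\mathrm{GJS}(P_1,P_2,\theta^\star_\gamma)=\gamma\theta^\star_\gamma$, and let $\alpha=\min\{\theta^\star_\gamma,\beta^\star_\gamma\}$. Suppose that Gutman's test is given $n=n_N$ test samples with $N/n_N\to\alpha$ (that is, $N/\min\{\theta^\star_\gamma,\beta^\star_\gamma\}$ test samples up to rounding), and that it uses its optimal threshold $\lambda^\star\ge 0$, the maximizer of $\lambda\mapsto\min\{\lambda,F_1(\alpha,\lambda)\}$ over $\lambda\ge0$. Then $$\mathsf e\big(\Phi_{\mathrm{GUT}}(\lambda^\star,\alpha)\big)<\gamma\le\mathsf e\big(\Phi_{\mathrm{seq}}(\gamma)\big),$$ so the Bayesian error exponent $\gamma$ that the sequential test is guaranteed to achieve, and a fortiori its Bayesian error exponent, is strictly greater than that of Gutman's test. -/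

import Mathlib

open Filter Topology MeasureTheory

namespace SeqClass

noncomputable section

/-! ### Information measures on a finite alphabet -/

/-- Kullback-Leibler divergence `D(P‖Q)` (natural logarithm, `0 log 0 = 0`) of two probability
vectors, for `P` absolutely continuous with respect to `Q`. Below it is only evaluated at such
pairs: the second argument has full support or is a mixture that charges the first one. -/
def kl {X : Type*} [Fintype X] (P Q : X → ℝ) : ℝ :=
  ∑ a, P a * Real.log (P a / Q a)

/-- The mixture `(α P + Q) / (1 + α)`. -/
def mix {X : Type*} (P Q : X → ℝ) (α : ℝ) : X → ℝ :=
  fun a => (α * P a + Q a) / (1 + α)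

/-- Generalized Jensen-Shannon divergence `GJS(P, Q, α)`. -/
def gjs {X : Type*} [Fintype X] (P Q : X → ℝ) (α : ℝ) : ℝ :=
  α * kl P (mix P Q α) + kl Q (mix P Q α)

/-- Chernoff information `C(P, Q) = - min_{η ∈ [0,1]} log ∑ P^η Q^(1-η)`. -/
def chernoff {X : Type*} [Fintype X] (P Q : X → ℝ) : ℝ :=
  - sInf ((fun η : ℝ => Real.log (∑ a, P a ^ η * Q a ^ (1 - η))) '' Set.Icc 0 1)

/-- The probability vector of a distribution. -/
def vec {X : Type*} (P : PMF X) : X → ℝ := fun a => (P a).toReal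

/-- The type (empirical distribution) of a sequence of length `n`. -/
def empType {X : Type*} [DecidableEq X] {n : ℕ} (x : Fin n → X) : X → ℝ :=
  fun a => (∑ i, if x i = a then (1 : ℝ) else 0) / n

/-- `F₁(α, lam)`: the minimum of `D(Q₁‖P₁) + D(Q₂‖P₂) / α` over all pairs of probability vectors
with `GJS(Q₁, Q₂, α) / α ≤ lam`. -/
def gutmanTradeoff {X : Type*} [Fintype X] (P₁ P₂ : X → ℝ) (α lam : ℝ) : ℝ :=
  sInf {v : ℝ | ∃ Q₁ ∈ stdSimplex ℝ X, ∃ Q₂ ∈ stdSimplex ℝ X,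
    gjs Q₁ Q₂ α / α ≤ lam ∧ v = kl Q₁ P₁ + kl Q₂ P₂ / α}

/-- `lam ≥ 0` attains `max_{lam ≥ 0} min {lam, F₁(α, lam)}`. -/
def IsOptimalThreshold {X : Type*} [Fintype X] (P₁ P₂ : X → ℝ) (α lam : ℝ) : Prop :=
  0 ≤ lam ∧ IsMaxOn (fun l => min l (gutmanTradeoff P₁ P₂ α l)) (Set.Ici 0) lam

/-! ### Tests and their error probabilities -/

/-- The two hypotheses: the test samples come from the source of the first, respectively the
second, training sequence. -/
inductive Hyp where
  | H₁ : Hyp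
  | H₂ : Hyp

/-- The data: two training sequences of length `N` and the stream `Y₁, Y₂, …` of test samples
(`Yₖ` is the entry with index `k - 1`). -/
structure Data (X : Type*) (N : ℕ) where
  /-- the two training sequences -/
  train : Hyp → Fin N → X
  /-- the test samples -/
  test : ℕ → X

/-- The first `n` test samples. -/
def Data.prefix {X : Type*} {N : ℕ} (ω : Data X N) (n : ℕ) : Fin n → X :=
  fun k => ω.test k

/-- Two data sets that agree on the training sequences and on the first `n` test samples, that is,
that cannot be told apart by `σ(X₁^N, X₂^N, Y₁, …, Yₙ)`. -/
def Data.Agree {X : Type*} {N : ℕ} (n : ℕ) (ω ω' : Data X N) : Prop :=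
  ω.train = ω'.train ∧ ∀ k < n, ω.test k = ω'.test k

/-- A test `(T, d)`: a stopping time `T` of the filtration generated by the training sequences and
the test samples, and a decision `d` that depends only on the data seen up to time `T`. (The
alphabet being finite, the two fields below say exactly `{T = n} ∈ ℱₙ` and `d` is
`ℱ_T`-measurable.) -/
structure Test (X : Type*) (N : ℕ) where
  /-- stopping time -/
  T : Data X N → ℕ
  /-- decision -/
  d : Data X N → Hyp
  stopping : ∀ ω ω', Data.Agree (T ω) ω ω' → T ω' = T ω
  adapted : ∀ ω ω', Data.Agree (T ω) ω ω' → d ω' = d ω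

/-- The distribution of the samples attached to a hypothesis. -/
def source {X : Type*} (P₁ P₂ : PMF X) : Hyp → PMF X
  | .H₁ => P₁
  | .H₂ => P₂

/-- The law of (first training sequence, second training sequence, test samples) under hypothesis
`i`: all samples are independent, the training samples have the laws `P₁` and `P₂`, and the test
samples have the law `P_i`. -/
def law {X : Type*} [MeasurableSpace X] (P₁ P₂ : PMF X) (N : ℕ) (i : Hyp) :
    Measure ((Fin N → X) × (Fin N → X) × (ℕ → X)) :=
  (Measure.pi fun _ => P₁.toMeasure).prod
    ((Measure.pi fun _ => P₂.toMeasure).prod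
      (Measure.infinitePi fun _ => (source P₁ P₂ i).toMeasure))

/-- Assemble the data from the three sample sequences. -/
def toData {X : Type*} {N : ℕ} (s : (Fin N → X) × (Fin N → X) × (ℕ → X)) : Data X N where
  train := fun
    | .H₁ => s.1
    | .H₂ => s.2.1
  test := s.2.2

/-- The error probability `P_i(d ≠ H_i)` of a test under hypothesis `i`. -/
def errProb {X : Type*} [MeasurableSpace X] (P₁ P₂ : PMF X) {N : ℕ} (Φ : Test X N) (i : Hyp) :
    ENNReal :=
  law P₁ P₂ N i {s | Φ.d (toData s) ≠ i}

/-- The average error probability for the prior `(p, 1 - p)` on the hypotheses. -/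
def bayesErr {X : Type*} [MeasurableSpace X] (P₁ P₂ : PMF X) (p : ℝ) {N : ℕ} (Φ : Test X N) :
    ENNReal :=
  ENNReal.ofReal p * errProb P₁ P₂ Φ .H₁ + ENNReal.ofReal (1 - p) * errProb P₁ P₂ Φ .H₂

/-- The Bayesian error exponent `liminf_N (- log P^err) / N` of a family of tests (an extended
real; `- log 0 = ∞`). -/
def bayesExponent {X : Type*} [MeasurableSpace X] (P₁ P₂ : PMF X) (p : ℝ)
    (Φ : ∀ N : ℕ, Test X N) : EReal :=
  liminf (fun N : ℕ => - ENNReal.log (bayesErr P₁ P₂ p (Φ N)) / (N : EReal)) atTop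

/-! ### The sequential test and Gutman's test -/

/-- The score of class `i` at time `n`: `n · GJS(type of X_i^N, type of Y^n, N / n)`. -/
def score {X : Type*} [Fintype X] [DecidableEq X] {N : ℕ} (i : Hyp) (n : ℕ) (ω : Data X N) : ℝ :=
  n * gjs (empType (ω.train i)) (empType (ω.prefix n)) ((N : ℝ) / n)

/-- The stopping time of the sequential test with threshold `γ`:
`inf {n ≥ 1 : some class has score ≥ γ N at time n} ∧ N²`. -/
def seqTime {X : Type*} [Fintype X] [DecidableEq X] {N : ℕ} (γ : ℝ) (ω : Data X N) : ℕ :=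
  sInf ({n : ℕ | 1 ≤ n ∧ ∃ i : Hyp, γ * N ≤ score i n ω} ∪ {N ^ 2})

/-- `Φ` is the sequential test with threshold `γ`: it stops at `seqTime γ`, and it decides for `H₁`
if it is the score of class 2 that has reached the threshold, and for `H₂` if it is that of
class 1. When both or neither of the scores have reached the threshold at that time, the rule
does not single out a decision and `Φ` may take either one. -/
def IsSeqTest {X : Type*} [Fintype X] [DecidableEq X] {N : ℕ} (γ : ℝ) (Φ : Test X N) : Prop :=
  ∀ ω : Data X N, Φ.T ω = seqTime γ ω ∧
    (γ * N ≤ score .H₂ (Φ.T ω) ω → score .H₁ (Φ.T ω) ω < γ * N → Φ.d ω = .H₁) ∧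
    (γ * N ≤ score .H₁ (Φ.T ω) ω → score .H₂ (Φ.T ω) ω < γ * N → Φ.d ω = .H₂)

/-- `Φ` is Gutman's test with threshold `lam` and ratio `α` that uses exactly `n` test samples: it
decides for `H₁` if `GJS(type of X₁^N, type of Y^n, α)` is below `lam * α`, and for `H₂` if it is
above. In the case of equality `Φ` may take either decision. -/
def IsGutmanTest {X : Type*} [Fintype X] [DecidableEq X] {N : ℕ} (lam α : ℝ) (n : ℕ)
    (Φ : Test X N) : Prop :=
  ∀ ω : Data X N, Φ.T ω = n ∧
    (gjs (empType (ω.train .H₁)) (empType (ω.prefix n)) α < lam * α → Φ.d ω = .H₁) ∧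
    (lam * α < gjs (empType (ω.train .H₁)) (empType (ω.prefix n)) α → Φ.d ω = .H₂)

end

end SeqClass

open SeqClass

namespace SeqClass

section

variable {X : Type*}

/-! ### Relative entropy of finite vectors -/

/-! Gutman's test. Call D(Q₁‖P₁) + D(Q₂‖P₂)/α the cost of a pair (Q₁, Q₂). By change of measure, a
pair with `gjs Q₁ Q₂ α < lam * α` and cost below γ makes errors under H₂ likely enough to push the
exponent below γ (`bayesExponent_gut_lt_of_pair`). At an optimal threshold such a pair exists as
soon as some pair has cost + GJS/α < γ, since otherwise raising the threshold would pay
(`IsOptimalThreshold.exists_pair`).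

By the compensation identity `gjs_le`, cost + GJS/α is at most D(Q₁‖P₁) + D(Q₁‖V) + (D(Q₂‖P₂) +
D(Q₂‖V))/α for every V dominating Q₁ and Q₂. At the normalized geometric means of P₁, V and P₂, V
this equals -2 log B(P₁,V) - 2 log B(P₂,V)/α, with B the Bhattacharyya coefficient. Since -2 log
B(P,V) < D(P‖V) when P ≠ V, the mixture V of P₁ and P₂ gives a value strictly below GJS(P₁,P₂,α)/α,
which is γ when α = θ. When α = β, the equation for γ has P₁ and P₂ interchanged while the cost has
not; a reflection exchanging √P₁ and √P₂ carries the mixture to a suitable V (`exists_reflection`).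

Sequential test. An error under Hᵢ means that the score of the true class i reaches γN by time N²,
or that the score of the other class j is still below γN at time N² (`IsSeqTest.score_of_ne`). The
first event has exponent γ at each time, by `gjs_le` with V = Pᵢ. In the second, with N² test
samples the type of Y is close to Pᵢ, so the type Q of the training sequence of class j satisfies
D(Q‖Pᵢ) ≲ γ. As γ is at most the Chernoff information, D(Q‖Pⱼ) ≳ γ (`eventually_le_of_score_lt`).
Polynomially many types and times do not affect exponents. -/

lemma sub_le_mul_log_div {q z : ℝ} (hq : 0 ≤ q) (hz : 0 ≤ z) (h : z = 0 → q = 0) :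
    q - z ≤ q * Real.log (q / z) := by
  rcases hq.eq_or_lt with rfl | hq
  · simpa using hz
  have hz' : 0 < z := lt_of_le_of_ne hz fun h0 => hq.ne' (h h0.symm)
  have h1 := Real.log_le_sub_one_of_pos (div_pos hz' hq)
  rw [← inv_div, Real.log_inv]
  have h2 : q * (z / q) = z := by field_simp
  nlinarith

/-- Since log(√q/√p) is half of log(q/p), the tangent bound for the roots, multiplied by 2√q,
completes a square. Summed over letters it bounds relative entropy below by the Hellinger distance.
-/
lemma sq_sqrt_sub_sqrt_le {q p : ℝ} (hq : 0 ≤ q) (hp : 0 ≤ p) (h : p = 0 → q = 0) :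
    (√q - √p) ^ 2 + (q - p) ≤ q * Real.log (q / p) := by
  have h1 := sub_le_mul_log_div (Real.sqrt_nonneg q) (Real.sqrt_nonneg p)
    (fun h0 => by rw [h ((Real.sqrt_eq_zero hp).1 h0)]; simp)
  rw [← Real.sqrt_div hq, Real.log_sqrt (div_nonneg hq hp)] at h1
  have h2 := mul_le_mul_of_nonneg_left h1 (Real.sqrt_nonneg q)
  rw [← mul_assoc, Real.mul_self_sqrt hq] at h2
  nlinarith [Real.sq_sqrt hq, Real.sq_sqrt hp]

/-- Pointwise form of the joint convexity of relative entropy. -/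
lemma mul_log_div_add_le {q p q' p' : ℝ} (hq : 0 ≤ q) (hp : 0 ≤ p) (h : p = 0 → q = 0)
    (hq' : 0 ≤ q') (hp' : 0 ≤ p') (h' : p' = 0 → q' = 0) :
    (q + q') * Real.log ((q + q') / (p + p')) ≤
      q * Real.log (q / p) + q' * Real.log (q' / p') := by
  rcases hq.eq_or_lt with rfl | hq
  · rcases hq'.eq_or_lt with rfl | hq'
    · simp
    have hp1 : 0 < p' := lt_of_le_of_ne hp' fun h0 => hq'.ne' (h' h0.symm)
    simp only [zero_add, zero_mul]
    gcongr
    linarith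
  have hp1 : 0 < p := lt_of_le_of_ne hp fun h0 => hq.ne' (h h0.symm)
  rcases hq'.eq_or_lt with rfl | hq'
  · simp only [add_zero, zero_mul]
    gcongr
    linarith
  have hp2 : 0 < p' := lt_of_le_of_ne hp' fun h0 => hq'.ne' (h' h0.symm)
  -- Tangent bound at the common ratio (q + q')/(p + p'); the two right-hand sides add up to zero by
  -- `e3`.
  have e : ∀ {u v : ℝ}, 0 < u → 0 < v → u * Real.log (u / v) - u * Real.log ((q + q') / (p + p'))
      ≥ u - v * ((q + q') / (p + p')) := by
    intro u v hu hv
    have := sub_le_mul_log_div hu.le (z := v * ((q + q') / (p + p'))) (by positivity)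
      (fun h0 => absurd h0 (by positivity))
    rw [← div_div, Real.log_div (by positivity) (by positivity)] at this
    linarith
  have e1 := e hq hp1
  have e2 := e hq' hp2
  have e3 : p * ((q + q') / (p + p')) + p' * ((q + q') / (p + p')) = q + q' := by
    field_simp
  nlinarith

lemma mix_eq_zero {P Q : X → ℝ} (hP : ∀ a, 0 ≤ P a) (hQ : ∀ a, 0 ≤ Q a) {α : ℝ}
    (hα : 0 < α) {a : X} (h : mix P Q α a = 0) : P a = 0 ∧ Q a = 0 := by
  have h1 := mul_nonneg hα.le (hP a)
  have h2 := hQ a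
  simp only [mix] at h
  rcases div_eq_zero_iff.1 h with h | h
  · exact ⟨(mul_eq_zero.1 (by linarith : α * P a = 0)).resolve_left hα.ne', by linarith⟩
  · linarith

lemma mix_pos {P Q : X → ℝ} (hP : ∀ a, 0 < P a) (hQ : ∀ a, 0 < Q a) {α : ℝ}
    (hα : 0 < α) (a : X) : 0 < mix P Q α a := by
  have := hP a
  have := hQ a
  unfold mix
  positivity

lemma mix_ne_right {P Q : X → ℝ} (hne : P ≠ Q) {α : ℝ} (hα : 0 < α) : mix P Q α ≠ Q := by
  intro h
  refine hne (funext fun a => ?_)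
  have := congrFun h a
  simp only [mix] at this
  rw [div_eq_iff (by positivity)] at this
  exact mul_left_cancel₀ hα.ne' (by linarith)

lemma mix_ne_left {P Q : X → ℝ} (hne : P ≠ Q) {α : ℝ} (hα : 0 < α) : mix P Q α ≠ P := by
  intro h
  refine hne (funext fun a => ?_)
  have := congrFun h a
  simp only [mix] at this
  rw [div_eq_iff (by positivity)] at this
  linarith

lemma mix_convex (P Q P' Q' : X → ℝ) (α t : ℝ) :
    mix (fun a => t * P a + (1 - t) * P' a) (fun a => t * Q a + (1 - t) * Q' a) α =
      fun a => t * mix P Q α a + (1 - t) * mix P' Q' α a := by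
  funext a
  simp only [mix]
  ring

variable [Fintype X]

/-- The squared Hellinger distance `∑ (√P - √Q)²`. -/
noncomputable def hellinger (P Q : X → ℝ) : ℝ := ∑ a, (√(P a) - √(Q a)) ^ 2

lemma hellinger_nonneg (P Q : X → ℝ) : 0 ≤ hellinger P Q :=
  Finset.sum_nonneg fun _ _ => sq_nonneg _

lemma hellinger_comm (P Q : X → ℝ) : hellinger P Q = hellinger Q P :=
  Finset.sum_congr rfl fun _ _ => by ring

lemma eq_of_hellinger_le_zero {P Q : X → ℝ} (hP : ∀ a, 0 ≤ P a) (hQ : ∀ a, 0 ≤ Q a)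
    (h : hellinger P Q ≤ 0) : P = Q := by
  have h0 := (Finset.sum_eq_zero_iff_of_nonneg fun a _ => sq_nonneg (√(P a) - √(Q a))).1
    (le_antisymm h (hellinger_nonneg P Q))
  funext a
  have := pow_eq_zero_iff (two_ne_zero) |>.1 (h0 a (Finset.mem_univ a))
  exact (Real.sqrt_inj (hP a) (hQ a)).1 (by linarith)

lemma hellinger_le_kl {P Q : X → ℝ} (hP : P ∈ stdSimplex ℝ X) (hQ : Q ∈ stdSimplex ℝ X)
    (h : ∀ a, Q a = 0 → P a = 0) : hellinger P Q ≤ kl P Q := by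
  have := Finset.sum_le_sum fun a (_ : a ∈ Finset.univ) =>
    sq_sqrt_sub_sqrt_le (hP.1 a) (hQ.1 a) (h a)
  rw [Finset.sum_add_distrib, Finset.sum_sub_distrib, hP.2, hQ.2] at this
  simpa [kl, hellinger] using this

lemma kl_nonneg {P Q : X → ℝ} (hP : P ∈ stdSimplex ℝ X) (hQ : Q ∈ stdSimplex ℝ X)
    (h : ∀ a, Q a = 0 → P a = 0) : 0 ≤ kl P Q :=
  (hellinger_nonneg P Q).trans (hellinger_le_kl hP hQ h)

/-- The gap of the masses is the gap of their roots times the sum of the roots, which is at most 2.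
With `hellinger_le_kl`, small divergence forces closeness letter by letter. -/
lemma sq_sub_le_hellinger {P Q : X → ℝ} (hP : P ∈ stdSimplex ℝ X) (hQ : Q ∈ stdSimplex ℝ X)
    (a : X) : (P a - Q a) ^ 2 ≤ 4 * hellinger P Q := by
  have h1 : (√(P a) - √(Q a)) ^ 2 ≤ hellinger P Q :=
    Finset.single_le_sum (f := fun a => (√(P a) - √(Q a)) ^ 2) (fun _ _ => sq_nonneg _)
      (Finset.mem_univ a)
  have bound : ∀ {R : X → ℝ}, R ∈ stdSimplex ℝ X → √(R a) ≤ 1 := fun {R} hR => by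
    rw [Real.sqrt_le_one]
    exact (Finset.single_le_sum (fun b _ => hR.1 b) (Finset.mem_univ a)).trans hR.2.le
  have h2 := bound hP
  have h3 := bound hQ
  have h4 : P a - Q a = (√(P a) - √(Q a)) * (√(P a) + √(Q a)) := by
    nlinarith [Real.sq_sqrt (hP.1 a), Real.sq_sqrt (hQ.1 a)]
  have h5 : (√(P a) + √(Q a)) ^ 2 ≤ 4 := by
    nlinarith [Real.sqrt_nonneg (P a), Real.sqrt_nonneg (Q a)]
  rw [h4, mul_pow]
  nlinarith [sq_nonneg (√(P a) - √(Q a))]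

/-- Cauchy-Schwarz for a sum of four differences. Relative entropy has no such triangle inequality,
hence the passage through roots. -/
lemma hellinger_chain_le (P Q R S T : X → ℝ) :
    hellinger P T ≤ 4 * (hellinger P Q + hellinger Q R + hellinger R S + hellinger S T) := by
  simp only [hellinger, ← Finset.sum_add_distrib, Finset.mul_sum]
  refine Finset.sum_le_sum fun a _ => ?_
  generalize √(P a) = p; generalize √(Q a) = q; generalize √(R a) = r
  generalize √(S a) = s; generalize √(T a) = t
  nlinarith [sq_nonneg ((p - q) - (q - r)), sq_nonneg ((p - q) - (r - s)),
    sq_nonneg ((p - q) - (s - t)), sq_nonneg ((q - r) - (r - s)),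
    sq_nonneg ((q - r) - (s - t)), sq_nonneg ((r - s) - (s - t))]

lemma kl_convex {P Q P' Q' : X → ℝ} (hP : ∀ a, 0 ≤ P a) (hQ : ∀ a, 0 ≤ Q a)
    (h : ∀ a, Q a = 0 → P a = 0) (hP' : ∀ a, 0 ≤ P' a) (hQ' : ∀ a, 0 ≤ Q' a)
    (h' : ∀ a, Q' a = 0 → P' a = 0) {t : ℝ} (ht : t ∈ Set.Ioo (0 : ℝ) 1) :
    kl (fun a => t * P a + (1 - t) * P' a) (fun a => t * Q a + (1 - t) * Q' a) ≤
      t * kl P Q + (1 - t) * kl P' Q' := by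
  have h0 := ht.1
  have h1 : 0 < 1 - t := by linarith [ht.2]
  simp only [kl, Finset.mul_sum, ← Finset.sum_add_distrib]
  refine Finset.sum_le_sum fun a _ => ?_
  refine (mul_log_div_add_le (mul_nonneg h0.le (hP a)) (mul_nonneg h0.le (hQ a))
    (fun e => by rw [h a ((mul_eq_zero.1 e).resolve_left h0.ne'), mul_zero])
    (mul_nonneg h1.le (hP' a)) (mul_nonneg h1.le (hQ' a))
    (fun e => by rw [h' a ((mul_eq_zero.1 e).resolve_left h1.ne'), mul_zero])).trans_eq ?_
  rw [mul_div_mul_left _ _ h0.ne', mul_div_mul_left _ _ h1.ne']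
  ring

lemma kl_self (P : X → ℝ) : kl P P = 0 := by
  refine Finset.sum_eq_zero fun a _ => ?_
  by_cases h : P a = 0 <;> simp [h]

/-! ### The generalized Jensen-Shannon divergence -/

lemma mix_mem {P Q : X → ℝ} (hP : P ∈ stdSimplex ℝ X) (hQ : Q ∈ stdSimplex ℝ X) {α : ℝ}
    (hα : 0 < α) : mix P Q α ∈ stdSimplex ℝ X := by
  refine ⟨fun a => div_nonneg (add_nonneg (mul_nonneg hα.le (hP.1 a)) (hQ.1 a)) (by linarith), ?_⟩
  simp only [mix]
  rw [← Finset.sum_div, Finset.sum_add_distrib, ← Finset.mul_sum, hP.2, hQ.2]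
  field_simp
  ring

lemma gjs_convex {P Q P' Q' : X → ℝ} (hP : ∀ a, 0 ≤ P a) (hQ : ∀ a, 0 ≤ Q a)
    (hP' : ∀ a, 0 ≤ P' a) (hQ' : ∀ a, 0 ≤ Q' a) {α : ℝ} (hα : 0 < α)
    {t : ℝ} (ht : t ∈ Set.Ioo (0 : ℝ) 1) :
    gjs (fun a => t * P a + (1 - t) * P' a) (fun a => t * Q a + (1 - t) * Q' a) α ≤
      t * gjs P Q α + (1 - t) * gjs P' Q' α := by
  have hm : ∀ {P Q : X → ℝ}, (∀ a, 0 ≤ P a) → (∀ a, 0 ≤ Q a) → ∀ a, 0 ≤ mix P Q α a :=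
    fun hP hQ a => div_nonneg (add_nonneg (mul_nonneg hα.le (hP a)) (hQ a)) (by linarith)
  simp only [gjs]
  rw [mix_convex]
  have h1 := kl_convex hP (hm hP hQ) (fun a h => (mix_eq_zero hP hQ hα h).1) hP' (hm hP' hQ')
    (fun a h => (mix_eq_zero hP' hQ' hα h).1) ht
  have h2 := kl_convex hQ (hm hP hQ) (fun a h => (mix_eq_zero hP hQ hα h).2) hQ' (hm hP' hQ')
    (fun a h => (mix_eq_zero hP' hQ' hα h).2) ht
  nlinarith

lemma gjs_self (P : X → ℝ) {α : ℝ} (hα : 0 < α) : gjs P P α = 0 := by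
  have : mix P P α = P := by
    funext a
    simp only [mix]
    field_simp
    ring
  simp [gjs, this, kl_self]

/-- Compensation identity, as an inequality. -/
lemma gjs_le {P Q V : X → ℝ} (hP : P ∈ stdSimplex ℝ X) (hQ : Q ∈ stdSimplex ℝ X)
    (hV : V ∈ stdSimplex ℝ X) (hPV : ∀ a, V a = 0 → P a = 0) (hQV : ∀ a, V a = 0 → Q a = 0)
    {α : ℝ} (hα : 0 < α) : gjs P Q α ≤ α * kl P V + kl Q V := by
  have hm := mix_mem hP hQ hα
  have h0 : 0 ≤ (1 + α) * kl (mix P Q α) V :=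
    mul_nonneg (by linarith) (kl_nonneg hm hV fun a h => by simp [mix, hPV a h, hQV a h])
  have key : α * kl P V + kl Q V = gjs P Q α + (1 + α) * kl (mix P Q α) V := by
    simp only [gjs, kl, Finset.mul_sum, ← Finset.sum_add_distrib]
    refine Finset.sum_congr rfl fun a _ => ?_
    by_cases hv : V a = 0
    · simp [hPV a hv, hQV a hv, mix]
    by_cases hma : mix P Q α a = 0
    · obtain ⟨h1, h2⟩ := mix_eq_zero hP.1 hQ.1 hα hma
      simp [h1, h2, mix]
    have e : ∀ u : ℝ, u * Real.log (u / V a) =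
        u * Real.log (u / mix P Q α a) + u * Real.log (mix P Q α a / V a) := by
      intro u
      by_cases hu : u = 0
      · simp [hu]
      rw [Real.log_div hu hv, Real.log_div hu hma, Real.log_div hma hv]
      ring
    rw [e (P a), e (Q a)]
    have : (1 + α) * (mix P Q α a * Real.log (mix P Q α a / V a)) =
        (α * P a + Q a) * Real.log (mix P Q α a / V a) := by
      rw [← mul_assoc]
      congr 1
      simp only [mix]
      field_simp
    rw [this]
    ring
  linarith

lemma gjs_nonneg {P Q : X → ℝ} (hP : P ∈ stdSimplex ℝ X) (hQ : Q ∈ stdSimplex ℝ X)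
    {α : ℝ} (hα : 0 < α) : 0 ≤ gjs P Q α :=
  add_nonneg (mul_nonneg hα.le (kl_nonneg hP (mix_mem hP hQ hα)
    fun _ h => (mix_eq_zero hP.1 hQ.1 hα h).1))
    (kl_nonneg hQ (mix_mem hP hQ hα) fun _ h => (mix_eq_zero hP.1 hQ.1 hα h).2)

end

section

variable {X : Type*} [Fintype X]

/-! ### Bhattacharyya coefficients -/

/-- The Bhattacharyya coefficient `∑ √P √Q`. -/
noncomputable def bhatt (P Q : X → ℝ) : ℝ := ∑ a, √(P a) * √(Q a)

/-- The normalized geometric mean of `P` and `Q`. -/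
noncomputable def geoMean (P Q : X → ℝ) : X → ℝ := fun a => √(P a) * √(Q a) / bhatt P Q

lemma bhatt_pos {Q P : X → ℝ} (hQ : Q ∈ stdSimplex ℝ X) (hP : ∀ a, 0 ≤ P a)
    (h : ∀ a, P a = 0 → Q a = 0) : 0 < bhatt Q P := by
  obtain ⟨a, -, ha⟩ : ∃ a ∈ Finset.univ, 0 < Q a := by
    by_contra! hc
    have := Finset.sum_nonpos hc
    rw [hQ.2] at this
    linarith
  have hpa : 0 < P a := lt_of_le_of_ne (hP a) fun h0 => ha.ne' (h a h0.symm)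
  exact Finset.sum_pos' (fun _ _ => by positivity) ⟨a, Finset.mem_univ a, by positivity⟩

lemma bhatt_comm (P Q : X → ℝ) : bhatt P Q = bhatt Q P :=
  Finset.sum_congr rfl fun _ _ => mul_comm _ _

lemma geoMean_mem {P Q : X → ℝ} (h : 0 < bhatt P Q) : geoMean P Q ∈ stdSimplex ℝ X := by
  refine ⟨fun a => by unfold geoMean; positivity, ?_⟩
  simp only [geoMean]
  rw [← Finset.sum_div]
  exact div_self h.ne'

/-- The logarithm of the geometric mean is the average of the two logarithms minus log B, so only
the normalization survives. Letters where `P` or `V` vanishes carry no mass. -/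
lemma kl_geoMean_add {P V : X → ℝ} (hP : ∀ a, 0 ≤ P a) (hV : ∀ a, 0 ≤ V a)
    (h : 0 < bhatt P V) :
    kl (geoMean P V) P + kl (geoMean P V) V = -2 * Real.log (bhatt P V) := by
  have e : ∀ a, geoMean P V a * Real.log (geoMean P V a / P a) +
      geoMean P V a * Real.log (geoMean P V a / V a) =
      geoMean P V a * (-2 * Real.log (bhatt P V)) := by
    intro a
    by_cases hp : P a = 0
    · simp [geoMean, hp]
    by_cases hv : V a = 0
    · simp [geoMean, hv]
    have hp' : 0 < P a := lt_of_le_of_ne (hP a) (Ne.symm hp)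
    have hv' : 0 < V a := lt_of_le_of_ne (hV a) (Ne.symm hv)
    have hg : 0 < geoMean P V a := by unfold geoMean; positivity
    have e1 : Real.log (geoMean P V a) =
        Real.log (P a) / 2 + Real.log (V a) / 2 - Real.log (bhatt P V) := by
      unfold geoMean
      rw [Real.log_div (by positivity) h.ne', Real.log_mul (by positivity) (by positivity),
        Real.log_sqrt hp'.le, Real.log_sqrt hv'.le]
    rw [Real.log_div hg.ne' hp, Real.log_div hg.ne' hv, e1]
    ring
  simp only [kl]
  rw [← Finset.sum_add_distrib, Finset.sum_congr rfl fun a _ => e a, ← Finset.sum_mul,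
    (geoMean_mem h).2, one_mul]

lemma kl_eq_two_mul_kl_geoMean {Q P : X → ℝ} (hQ : Q ∈ stdSimplex ℝ X) (hP : ∀ a, 0 ≤ P a)
    (h : ∀ a, P a = 0 → Q a = 0) :
    kl Q P = 2 * kl Q (geoMean Q P) - 2 * Real.log (bhatt Q P) := by
  have hb := bhatt_pos hQ hP h
  have e : ∀ a, Q a * Real.log (Q a / P a) =
      2 * (Q a * Real.log (Q a / geoMean Q P a)) - Q a * (2 * Real.log (bhatt Q P)) := by
    intro a
    by_cases hq : Q a = 0
    · simp [hq]
    have hp : P a ≠ 0 := fun h0 => hq (h a h0)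
    have hq' : 0 < Q a := lt_of_le_of_ne (hQ.1 a) (Ne.symm hq)
    have hp' : 0 < P a := lt_of_le_of_ne (hP a) (Ne.symm hp)
    have hg : 0 < geoMean Q P a := by unfold geoMean; positivity
    have e1 : Real.log (geoMean Q P a) =
        Real.log (Q a) / 2 + Real.log (P a) / 2 - Real.log (bhatt Q P) := by
      unfold geoMean
      rw [Real.log_div (by positivity) hb.ne', Real.log_mul (by positivity) (by positivity),
        Real.log_sqrt hq'.le, Real.log_sqrt hp'.le]
    rw [Real.log_div hq hg.ne', Real.log_div hq hp, e1]
    ring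
  simp only [kl]
  rw [Finset.sum_congr rfl fun a _ => e a, Finset.sum_sub_distrib, ← Finset.mul_sum,
    ← Finset.sum_mul, hQ.2, one_mul]

lemma geoMean_eq_zero {P Q : X → ℝ} (hP : ∀ a, 0 ≤ P a) (hQ : ∀ a, 0 ≤ Q a)
    (h : 0 < bhatt P Q) {a : X} (ha : geoMean P Q a = 0) : P a = 0 ∨ Q a = 0 := by
  rcases div_eq_zero_iff.1 ha with h0 | h0
  · rcases mul_eq_zero.1 h0 with h0 | h0
    · exact Or.inl ((Real.sqrt_eq_zero (hP a)).1 h0)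
    · exact Or.inr ((Real.sqrt_eq_zero (hQ a)).1 h0)
  · exact absurd h0 h.ne'

lemma neg_two_mul_log_bhatt_lt {Q P : X → ℝ} (hQ : Q ∈ stdSimplex ℝ X)
    (hP : P ∈ stdSimplex ℝ X) (hQ0 : ∀ a, 0 < Q a) (hP0 : ∀ a, 0 < P a) (hne : Q ≠ P) :
    -2 * Real.log (bhatt Q P) < kl Q P := by
  have h : ∀ a, P a = 0 → Q a = 0 := fun a h0 => absurd h0 (hP0 a).ne'
  have hb := bhatt_pos hQ hP.1 h
  have hg := geoMean_mem hb
  have h1 := hellinger_le_kl hQ hg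
    fun a ha => (geoMean_eq_zero hQ.1 hP.1 hb ha).elim id (h a)
  rw [kl_eq_two_mul_kl_geoMean hQ hP.1 h]
  by_contra! hc
  -- Equality would force `Q` to be its own geometric mean with `P`, hence `P` proportional to `Q`,
  -- and the normalization makes them equal.
  have h2 : Q = geoMean Q P := eq_of_hellinger_le_zero hQ.1 hg.1 (by linarith)
  have h3 : ∀ a, P a = bhatt Q P ^ 2 * Q a := fun a => by
    have h4 := congrFun h2 a
    have h5 : 0 < √(Q a) := Real.sqrt_pos.2 (hQ0 a)
    have h6 : √(P a) = bhatt Q P * √(Q a) := by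
      have h7 : Q a * bhatt Q P = √(Q a) * √(P a) := (eq_div_iff hb.ne').1 h4
      have : √(Q a) * (bhatt Q P * √(Q a)) = √(Q a) * √(P a) := by
        linear_combination h7 + bhatt Q P * Real.mul_self_sqrt (hQ0 a).le
      exact (mul_left_cancel₀ h5.ne' this).symm
    rw [← Real.sq_sqrt (hP0 a).le, h6, mul_pow, Real.sq_sqrt (hQ0 a).le]
  have h9 : bhatt Q P ^ 2 = 1 := by
    have := hP.2
    rwa [Finset.sum_congr rfl fun a _ => h3 a, ← Finset.mul_sum, hQ.2, mul_one] at this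
  exact hne (funext fun a => by rw [h3 a, h9, one_mul])

/-- A reflection of the unit sphere that exchanges `√P₁` and `√P₂` turns `√M` into a vector `√V`,
up to signs, whose affinities with `P₁` and `P₂` are at least those of `M` with `P₂` and `P₁`. -/
lemma exists_reflection {P₁ P₂ M : X → ℝ} (h₁ : P₁ ∈ stdSimplex ℝ X) (h₂ : P₂ ∈ stdSimplex ℝ X)
    (hM : M ∈ stdSimplex ℝ X) (hne : P₁ ≠ P₂) :
    ∃ V ∈ stdSimplex ℝ X, bhatt P₂ M ≤ bhatt P₁ V ∧ bhatt P₁ M ≤ bhatt P₂ V := by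
  set h := hellinger P₁ P₂ with hh
  have hpos : 0 < h := by
    by_contra! hc
    exact hne (eq_of_hellinger_le_zero h₁.1 h₂.1 hc)
  have norm : ∀ {P : X → ℝ}, P ∈ stdSimplex ℝ X → ∑ a, √(P a) * √(P a) = 1 := fun {P} hP => by
    rw [← hP.2]
    exact Finset.sum_congr rfl fun a _ => Real.mul_self_sqrt (hP.1 a)
  set ρ := bhatt P₁ P₂ with hρ
  have hhρ : h = 2 - 2 * ρ := by
    have : h = ∑ a, √(P₁ a) * √(P₁ a) + ∑ a, √(P₂ a) * √(P₂ a) - 2 * ρ := by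
      rw [hh, hρ, hellinger, bhatt, Finset.mul_sum, ← Finset.sum_add_distrib,
        ← Finset.sum_sub_distrib]
      exact Finset.sum_congr rfl fun a _ => by ring
    rw [this, norm h₁, norm h₂]
    ring
  set x := bhatt P₁ M with hx
  set y := bhatt P₂ M with hy
  -- The reflection in the hyperplane orthogonal to w = √P₁ - √P₂ subtracts 2⟨√M, w⟩/‖w‖² times w.
  set κ := 2 * (x - y) / h with hκ
  have hκh : κ * h = 2 * (x - y) := by rw [hκ]; field_simp
  set v : X → ℝ := fun a => √(M a) - κ * (√(P₁ a) - √(P₂ a)) with hv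
  have hv1 : ∑ a, √(P₁ a) * v a = y := by
    have : ∑ a, √(P₁ a) * v a = x - κ * (∑ a, √(P₁ a) * √(P₁ a) - ρ) := by
      rw [hx, hρ, bhatt, bhatt, ← Finset.sum_sub_distrib, Finset.mul_sum,
        ← Finset.sum_sub_distrib]
      exact Finset.sum_congr rfl fun a _ => by simp only [hv]; ring
    rw [this, norm h₁]
    linear_combination -(1 / 2) * hκh + κ / 2 * hhρ
  have hv2 : ∑ a, √(P₂ a) * v a = x := by
    have : ∑ a, √(P₂ a) * v a = y - κ * (ρ - ∑ a, √(P₂ a) * √(P₂ a)) := by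
      rw [hy, hρ, bhatt, bhatt, ← Finset.sum_sub_distrib, Finset.mul_sum,
        ← Finset.sum_sub_distrib]
      exact Finset.sum_congr rfl fun a _ => by simp only [hv]; ring
    rw [this, norm h₂]
    linear_combination (1 / 2) * hκh - κ / 2 * hhρ
  have hvv : ∑ a, v a ^ 2 = 1 := by
    have : ∑ a, v a ^ 2 = ∑ a, √(M a) * √(M a) - 2 * κ * (x - y) + κ ^ 2 * h := by
      rw [hx, hy, hh, bhatt, bhatt, hellinger, ← Finset.sum_sub_distrib, Finset.mul_sum,
        Finset.mul_sum, ← Finset.sum_sub_distrib, ← Finset.sum_add_distrib]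
      exact Finset.sum_congr rfl fun a _ => by simp only [hv]; ring
    rw [this, norm hM]
    linear_combination κ * hκh
  -- `v` may have negative entries. The root of `v a ^ 2` is its absolute value, so dropping signs
  -- can only increase the affinities.
  have habs : ∀ a, v a ≤ √(v a ^ 2) := fun a => by
    rw [Real.sqrt_sq_eq_abs]
    exact le_abs_self _
  refine ⟨fun a => v a ^ 2, ⟨fun a => sq_nonneg _, hvv⟩, ?_, ?_⟩
  · rw [← hv1]
    exact Finset.sum_le_sum fun a _ => mul_le_mul_of_nonneg_left (habs a) (Real.sqrt_nonneg _)
  · rw [← hv2]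
    exact Finset.sum_le_sum fun a _ => mul_le_mul_of_nonneg_left (habs a) (Real.sqrt_nonneg _)

/-! ### Pairs of distributions that are hard for Gutman's test -/

/-- The witnesses are the geometric means of `P₁`, `V` and of `P₂`, `V`, with the GJS term bounded
through the reference `V`. -/
lemma exists_pair_lt_of_bhatt {P₁ P₂ V : X → ℝ} (h₁ : P₁ ∈ stdSimplex ℝ X)
    (h₂ : P₂ ∈ stdSimplex ℝ X) (hV : V ∈ stdSimplex ℝ X) (pos₁ : ∀ a, 0 < P₁ a)
    (pos₂ : ∀ a, 0 < P₂ a) {α γ : ℝ} (hα : 0 < α)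
    (h : -2 * Real.log (bhatt P₁ V) + -2 * Real.log (bhatt P₂ V) / α < γ) :
    ∃ Q₁ ∈ stdSimplex ℝ X, ∃ Q₂ ∈ stdSimplex ℝ X,
      kl Q₁ P₁ + kl Q₂ P₂ / α + gjs Q₁ Q₂ α / α < γ := by
  have hb : ∀ {P : X → ℝ}, P ∈ stdSimplex ℝ X → (∀ a, 0 < P a) → 0 < bhatt P V :=
    fun {P} hP pos => by
      rw [bhatt_comm]
      exact bhatt_pos hV hP.1 fun a h0 => absurd h0 (pos a).ne'
  have hb₁ := hb h₁ pos₁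
  have hb₂ := hb h₂ pos₂
  refine ⟨geoMean P₁ V, geoMean_mem hb₁, geoMean P₂ V, geoMean_mem hb₂, ?_⟩
  have hg := gjs_le (geoMean_mem hb₁) (geoMean_mem hb₂) hV
    (fun a h0 => by simp [geoMean, h0]) (fun a h0 => by simp [geoMean, h0]) hα
  have e : gjs (geoMean P₁ V) (geoMean P₂ V) α / α ≤
      kl (geoMean P₁ V) V + kl (geoMean P₂ V) V / α := by
    rw [div_le_iff₀ hα, add_mul, div_mul_cancel₀ _ hα.ne']
    linarith
  have e₁ := kl_geoMean_add h₁.1 hV.1 hb₁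
  have e₂ := kl_geoMean_add h₂.1 hV.1 hb₂
  rw [← e₁, ← e₂, add_div] at h
  linarith

lemma exists_pair_lt_of_gjs {P₁ P₂ : X → ℝ} (h₁ : P₁ ∈ stdSimplex ℝ X)
    (h₂ : P₂ ∈ stdSimplex ℝ X) (pos₁ : ∀ a, 0 < P₁ a) (pos₂ : ∀ a, 0 < P₂ a) (hne : P₁ ≠ P₂)
    {α : ℝ} (hα : 0 < α) :
    ∃ Q₁ ∈ stdSimplex ℝ X, ∃ Q₂ ∈ stdSimplex ℝ X,
      kl Q₁ P₁ + kl Q₂ P₂ / α + gjs Q₁ Q₂ α / α < gjs P₁ P₂ α / α := by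
  have hM := mix_mem h₁ h₂ hα
  have hMpos := mix_pos pos₁ pos₂ hα
  refine exists_pair_lt_of_bhatt h₁ h₂ hM pos₁ pos₂ hα ?_
  have k₁ := neg_two_mul_log_bhatt_lt h₁ hM pos₁ hMpos (mix_ne_left hne hα).symm
  have k₂ := neg_two_mul_log_bhatt_lt h₂ hM pos₂ hMpos (mix_ne_right hne hα).symm
  have : gjs P₁ P₂ α / α = kl P₁ (mix P₁ P₂ α) + kl P₂ (mix P₁ P₂ α) / α := by
    rw [gjs]; field_simp
  rw [this]
  gcongr

lemma exists_pair_lt_of_gjs_swap {P₁ P₂ : X → ℝ} (h₁ : P₁ ∈ stdSimplex ℝ X)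
    (h₂ : P₂ ∈ stdSimplex ℝ X) (pos₁ : ∀ a, 0 < P₁ a) (pos₂ : ∀ a, 0 < P₂ a) (hne : P₁ ≠ P₂)
    {α : ℝ} (hα : 0 < α) :
    ∃ Q₁ ∈ stdSimplex ℝ X, ∃ Q₂ ∈ stdSimplex ℝ X,
      kl Q₁ P₁ + kl Q₂ P₂ / α + gjs Q₁ Q₂ α / α < gjs P₂ P₁ α / α := by
  have hM := mix_mem h₂ h₁ hα
  have hMpos := mix_pos pos₂ pos₁ hα
  obtain ⟨V, hV, hV₁, hV₂⟩ := exists_reflection h₁ h₂ hM hne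
  refine exists_pair_lt_of_bhatt h₁ h₂ hV pos₁ pos₂ hα ?_
  have k₁ := neg_two_mul_log_bhatt_lt h₁ hM pos₁ hMpos (mix_ne_right hne.symm hα).symm
  have k₂ := neg_two_mul_log_bhatt_lt h₂ hM pos₂ hMpos (mix_ne_left hne.symm hα).symm
  have l₁ := Real.log_le_log
    (bhatt_pos h₂ hM.1 fun a h0 => absurd h0 (hMpos a).ne') hV₁
  have l₂ := Real.log_le_log
    (bhatt_pos h₁ hM.1 fun a h0 => absurd h0 (hMpos a).ne') hV₂
  have : gjs P₂ P₁ α / α = kl P₂ (mix P₂ P₁ α) + kl P₁ (mix P₂ P₁ α) / α := by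
    rw [gjs]; field_simp
  rw [this]
  have d₁ : -2 * Real.log (bhatt P₁ V) < kl P₂ (mix P₂ P₁ α) := by linarith
  have d₂ : -2 * Real.log (bhatt P₂ V) < kl P₁ (mix P₂ P₁ α) := by linarith
  gcongr

/-! ### The optimal threshold of Gutman's test -/

lemma kl_nonneg_of_pos {P Q : X → ℝ} (hP : P ∈ stdSimplex ℝ X) (hQ : Q ∈ stdSimplex ℝ X)
    (pos : ∀ a, 0 < Q a) : 0 ≤ kl P Q :=
  kl_nonneg hP hQ fun a h0 => absurd h0 (pos a).ne'

lemma le_gutmanTradeoff {P₁ P₂ : X → ℝ} (h₁ : P₁ ∈ stdSimplex ℝ X) {α l c : ℝ} (hα : 0 < α)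
    (hl : 0 ≤ l)
    (h : ∀ Q₁ ∈ stdSimplex ℝ X, ∀ Q₂ ∈ stdSimplex ℝ X, gjs Q₁ Q₂ α / α ≤ l →
      c ≤ kl Q₁ P₁ + kl Q₂ P₂ / α) :
    c ≤ gutmanTradeoff P₁ P₂ α l := by
  -- The pair (P₁, P₁) has zero GJS, so the feasible set is nonempty; an empty one would give the
  -- default infimum 0.
  refine le_csInf ⟨_, P₁, h₁, P₁, h₁, ?_, rfl⟩ ?_
  · rwa [gjs_self _ hα, zero_div]
  · rintro v ⟨Q₁, hQ₁, Q₂, hQ₂, hle, rfl⟩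
    exact h Q₁ hQ₁ Q₂ hQ₂ hle

/-- The chain P₁, Q₁, mixture, Q₂, P₂ bounds the distance of the sources by four divergences. Thus
cost and GJS cannot both be small. -/
lemma hellinger_le_of_pair {P₁ P₂ : X → ℝ} (h₁ : P₁ ∈ stdSimplex ℝ X)
    (h₂ : P₂ ∈ stdSimplex ℝ X) (pos₁ : ∀ a, 0 < P₁ a) (pos₂ : ∀ a, 0 < P₂ a) {α : ℝ}
    (hα : 0 < α) {Q₁ Q₂ : X → ℝ} (hQ₁ : Q₁ ∈ stdSimplex ℝ X) (hQ₂ : Q₂ ∈ stdSimplex ℝ X) :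
    hellinger P₁ P₂ ≤
      4 * (1 + α) * (kl Q₁ P₁ + kl Q₂ P₂ / α + gjs Q₁ Q₂ α / α) := by
  have hM := mix_mem hQ₁ hQ₂ hα
  have c := hellinger_chain_le P₁ Q₁ (mix Q₁ Q₂ α) Q₂ P₂
  rw [hellinger_comm P₁ Q₁, hellinger_comm _ Q₂] at c
  have a₁ := hellinger_le_kl hQ₁ h₁ fun a h0 => absurd h0 (pos₁ a).ne'
  have a₂ := hellinger_le_kl hQ₂ h₂ fun a h0 => absurd h0 (pos₂ a).ne'
  have a₃ := hellinger_le_kl hQ₁ hM fun a h0 => (mix_eq_zero hQ₁.1 hQ₂.1 hα h0).1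
  have a₄ := hellinger_le_kl hQ₂ hM fun a h0 => (mix_eq_zero hQ₁.1 hQ₂.1 hα h0).2
  have n₁ := (hellinger_nonneg _ _).trans a₁
  have n₂ := (hellinger_nonneg _ _).trans a₂
  have n₃ := (hellinger_nonneg _ _).trans a₃
  have n₄ := (hellinger_nonneg _ _).trans a₄
  have e : 4 * (1 + α) * (kl Q₁ P₁ + kl Q₂ P₂ / α + gjs Q₁ Q₂ α / α) =
      4 * (1 + α) * kl Q₁ P₁ + 4 * (1 + 1 / α) * kl Q₂ P₂ +
        4 * (1 + α) * kl Q₁ (mix Q₁ Q₂ α) + 4 * (1 + 1 / α) * kl Q₂ (mix Q₁ Q₂ α) := by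
    rw [gjs]; field_simp; ring
  have hα' : 0 < 1 / α := by positivity
  rw [e]
  nlinarith [mul_nonneg hα.le n₁, mul_nonneg hα.le n₃, mul_nonneg hα'.le n₂,
    mul_nonneg hα'.le n₄]

lemma IsOptimalThreshold.pos {P₁ P₂ : X → ℝ} (h₁ : P₁ ∈ stdSimplex ℝ X)
    (h₂ : P₂ ∈ stdSimplex ℝ X) (pos₁ : ∀ a, 0 < P₁ a) (pos₂ : ∀ a, 0 < P₂ a) (hne : P₁ ≠ P₂)
    {α lam : ℝ} (hα : 0 < α) (h : IsOptimalThreshold P₁ P₂ α lam) : 0 < lam := by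
  have hpos : 0 < hellinger P₁ P₂ := by
    by_contra! hc
    exact hne (eq_of_hellinger_le_zero h₁.1 h₂.1 hc)
  -- By `hellinger_le_of_pair`, cost + GJS/α is at least 2c. If GJS/α ≤ c, the cost is at least c,
  -- so the threshold c already achieves a positive minimum.
  set c := hellinger P₁ P₂ / (8 * (1 + α)) with hc
  have hc0 : 0 < c := by positivity
  have hF : c ≤ gutmanTradeoff P₁ P₂ α c := by
    refine le_gutmanTradeoff h₁ hα hc0.le fun Q₁ hQ₁ Q₂ hQ₂ hle => ?_
    have := hellinger_le_of_pair h₁ h₂ pos₁ pos₂ hα hQ₁ hQ₂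
    have e : hellinger P₁ P₂ = 4 * (1 + α) * (2 * c) := by rw [hc]; field_simp; ring
    rw [e] at this
    have := le_of_mul_le_mul_left this (by positivity)
    linarith
  have : min c (gutmanTradeoff P₁ P₂ α c) ≤ min lam (gutmanTradeoff P₁ P₂ α lam) :=
    h.2 (Set.mem_Ici.2 hc0.le)
  rw [min_eq_left hF] at this
  exact hc0.trans_le (this.trans (min_le_left _ _))

lemma conv_mem {P Q : X → ℝ} (hP : P ∈ stdSimplex ℝ X) (hQ : Q ∈ stdSimplex ℝ X) {t : ℝ}
    (ht : t ∈ Set.Ioo (0 : ℝ) 1) : (fun a => t * P a + (1 - t) * Q a) ∈ stdSimplex ℝ X :=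
  convex_stdSimplex ℝ X hP hQ ht.1.le (by linarith [ht.2]) (by ring)

lemma kl_convex_left {Q Q' P : X → ℝ} (hQ : Q ∈ stdSimplex ℝ X) (hQ' : Q' ∈ stdSimplex ℝ X)
    (pos : ∀ a, 0 < P a) {t : ℝ} (ht : t ∈ Set.Ioo (0 : ℝ) 1) :
    kl (fun a => t * Q a + (1 - t) * Q' a) P ≤ t * kl Q P + (1 - t) * kl Q' P := by
  have := kl_convex hQ.1 (fun a => (pos a).le) (fun a h0 => absurd h0 (pos a).ne') hQ'.1
    (fun a => (pos a).le) (fun a h0 => absurd h0 (pos a).ne') ht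
  have e : (fun a => t * P a + (1 - t) * P a) = P := funext fun a => by ring
  rwa [e] at this

/-- If every pair strictly below the threshold cost at least γ, then `lam < γ`. Shrinking a pair
towards (P₁, P₁) shows that at a slightly larger threshold the tradeoff still exceeds `lam`, against
optimality. -/
lemma IsOptimalThreshold.exists_pair {P₁ P₂ : X → ℝ} (h₁ : P₁ ∈ stdSimplex ℝ X)
    (h₂ : P₂ ∈ stdSimplex ℝ X) (pos₁ : ∀ a, 0 < P₁ a) (pos₂ : ∀ a, 0 < P₂ a) (hne : P₁ ≠ P₂)
    {α lam γ : ℝ} (hα : 0 < α) (h : IsOptimalThreshold P₁ P₂ α lam)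
    (hQ : ∃ Q₁ ∈ stdSimplex ℝ X, ∃ Q₂ ∈ stdSimplex ℝ X,
      kl Q₁ P₁ + kl Q₂ P₂ / α + gjs Q₁ Q₂ α / α < γ) :
    ∃ Q₁ ∈ stdSimplex ℝ X, ∃ Q₂ ∈ stdSimplex ℝ X,
      gjs Q₁ Q₂ α / α < lam ∧ kl Q₁ P₁ + kl Q₂ P₂ / α < γ := by
  by_contra! hc
  have hlam := h.pos h₁ h₂ pos₁ pos₂ hne hα
  obtain ⟨Q₁, hQ₁, Q₂, hQ₂, hlt⟩ := hQ
  have n₁ := kl_nonneg_of_pos hQ₁ h₁ pos₁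
  have n₂ := div_nonneg (kl_nonneg_of_pos hQ₂ h₂ pos₂) hα.le
  have n₃ := div_nonneg (gjs_nonneg hQ₁ hQ₂ hα) hα.le
  have hlamγ : lam < γ := by
    by_contra! hle
    have := hc Q₁ hQ₁ Q₂ hQ₂ (by linarith)
    linarith
  set K := kl P₁ P₂ / α with hK
  have hK0 : 0 ≤ K := div_nonneg (kl_nonneg_of_pos h₁ h₂ pos₂) hα.le
  -- The weight of (P₁, P₁), small enough that its cost `u * K` stays below the gap `γ - lam`.
  set u := min (1 / 2) ((γ - lam) / (2 * (K + 1))) with hu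
  have hu0 : 0 < u := lt_min (by norm_num) (div_pos (by linarith) (by linarith))
  have hu1 : u ≤ 1 / 2 := min_le_left _ _
  have hu2 : u * K < γ - lam := by
    have : u ≤ (γ - lam) / (2 * (K + 1)) := min_le_right _ _
    rw [le_div_iff₀ (by linarith)] at this
    nlinarith
  set t := 1 - u with ht
  have ht1 : t ∈ Set.Ioo (0 : ℝ) 1 := ⟨by linarith, by linarith⟩
  -- The midpoint of `lam` and `lam / t`: above `lam`, while shrinking by `t` brings it below. This
  -- needs `lam > 0`.
  set l := lam * (1 + t) / (2 * t) with hl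
  have hll : lam < l := by
    rw [hl, lt_div_iff₀ (by linarith [ht1.1])]
    nlinarith [ht1.2]
  have htl : t * l < lam := by
    have : t * l = lam * (1 + t) / 2 := by
      rw [hl]
      have := ht1.1.ne'
      field_simp
    rw [this]
    nlinarith [ht1.2]
  have hF : (γ - u * K) / t ≤ gutmanTradeoff P₁ P₂ α l := by
    refine le_gutmanTradeoff h₁ hα (by linarith) fun R₁ hR₁ R₂ hR₂ hle => ?_
    have hg := gjs_convex hR₁.1 hR₂.1 h₁.1 h₁.1 hα ht1
    rw [gjs_self _ hα, mul_zero, add_zero] at hg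
    have hg' : gjs (fun a => t * R₁ a + (1 - t) * P₁ a) (fun a => t * R₂ a + (1 - t) * P₁ a) α / α
        < lam := by
      refine lt_of_le_of_lt ?_ htl
      calc _ ≤ t * gjs R₁ R₂ α / α := by gcongr
        _ = t * (gjs R₁ R₂ α / α) := by ring
        _ ≤ _ := mul_le_mul_of_nonneg_left hle ht1.1.le
    have hcost := hc _ (conv_mem hR₁ h₁ ht1) _ (conv_mem hR₂ h₁ ht1) hg'
    have k₁ := kl_convex_left hR₁ h₁ pos₁ ht1
    have k₂ := div_le_div_of_nonneg_right (kl_convex_left hR₂ h₁ pos₂ ht1) hα.le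
    rw [kl_self, mul_zero, add_zero] at k₁
    rw [div_le_iff₀ ht1.1]
    have e : (t * kl R₂ P₂ + (1 - t) * kl P₁ P₂) / α = t * (kl R₂ P₂ / α) + u * K := by
      rw [hK, ht]; ring
    rw [e] at k₂
    linarith
  have hlt' : lam < (γ - u * K) / t := by
    rw [lt_div_iff₀ ht1.1]
    nlinarith
  have : min l (gutmanTradeoff P₁ P₂ α l) ≤ min lam (gutmanTradeoff P₁ P₂ α lam) :=
    h.2 (Set.mem_Ici.2 (show 0 ≤ l by linarith))
  have h3 := lt_min hll (hlt'.trans_le hF)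
  linarith [min_le_left lam (gutmanTradeoff P₁ P₂ α lam)]

/-- A pair of distributions can be moved into the interior of the simplex. -/
lemma exists_pos_pair {P₁ P₂ : X → ℝ} (h₁ : P₁ ∈ stdSimplex ℝ X)
    (h₂ : P₂ ∈ stdSimplex ℝ X) (pos₁ : ∀ a, 0 < P₁ a) (pos₂ : ∀ a, 0 < P₂ a)
    {α lam γ : ℝ} (hα : 0 < α)
    (hQ : ∃ Q₁ ∈ stdSimplex ℝ X, ∃ Q₂ ∈ stdSimplex ℝ X,
      gjs Q₁ Q₂ α / α < lam ∧ kl Q₁ P₁ + kl Q₂ P₂ / α < γ) :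
    ∃ Q₁ ∈ stdSimplex ℝ X, ∃ Q₂ ∈ stdSimplex ℝ X, (∀ a, 0 < Q₁ a) ∧ (∀ a, 0 < Q₂ a) ∧
      gjs Q₁ Q₂ α < lam * α ∧ kl Q₁ P₁ + kl Q₂ P₂ / α < γ := by
  obtain ⟨Q₁, hQ₁, Q₂, hQ₂, hg, hk⟩ := hQ
  rw [div_lt_iff₀ hα] at hg
  set G := gjs P₁ P₂ α with hG
  have hG0 : 0 ≤ G := gjs_nonneg h₁ h₂ hα
  -- Mixing with (P₁, P₂) does not increase the cost and adds at most `u * G` to the GJS; `u` keeps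
  -- this within the available slack. Full support is needed for the change of measure and for
  -- continuity of the GJS.
  set u := min (1 / 2) ((lam * α - gjs Q₁ Q₂ α) / (2 * (G + 1))) with hu
  have hu0 : 0 < u := lt_min (by norm_num) (div_pos (by linarith) (by linarith))
  have hu1 : u ≤ 1 / 2 := min_le_left _ _
  have hu2 : u * G < lam * α - gjs Q₁ Q₂ α := by
    have : u ≤ (lam * α - gjs Q₁ Q₂ α) / (2 * (G + 1)) := min_le_right _ _
    rw [le_div_iff₀ (by linarith)] at this
    nlinarith
  set t := 1 - u with ht
  have ht1 : t ∈ Set.Ioo (0 : ℝ) 1 := ⟨by linarith, by linarith⟩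
  have hpos : ∀ {Q P : X → ℝ}, (∀ a, 0 ≤ Q a) → (∀ a, 0 < P a) → ∀ a, 0 < t * Q a + (1 - t) * P a :=
    fun hQ pos a => add_pos_of_nonneg_of_pos (mul_nonneg ht1.1.le (hQ a))
      (mul_pos (by linarith [ht1.2]) (pos a))
  refine ⟨_, conv_mem hQ₁ h₁ ht1, _, conv_mem hQ₂ h₂ ht1, hpos hQ₁.1 pos₁, hpos hQ₂.1 pos₂, ?_, ?_⟩
  · have := gjs_convex hQ₁.1 hQ₂.1 h₁.1 h₂.1 hα ht1
    have := gjs_nonneg hQ₁ hQ₂ hα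
    nlinarith [ht1.2]
  · have k₁ := kl_convex_left hQ₁ h₁ pos₁ ht1
    have k₂ := kl_convex_left hQ₂ h₂ pos₂ ht1
    rw [kl_self, mul_zero, add_zero] at k₁ k₂
    have n₁ := kl_nonneg_of_pos hQ₁ h₁ pos₁
    have n₂ := kl_nonneg_of_pos hQ₂ h₂ pos₂
    have k₃ := div_le_div_of_nonneg_right
      (k₂.trans (mul_le_of_le_one_left n₂ ht1.2.le)) hα.le
    have := mul_le_of_le_one_left n₁ ht1.2.le
    linarith

end

section

variable {X : Type*}

/-! ### The method of types -/

/-- The probability of a sequence of independent samples with distribution `P`. -/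
noncomputable def seqProb (P : X → ℝ) {n : ℕ} (x : Fin n → X) : ℝ := ∏ i, P (x i)

lemma seqProb_nonneg {P : X → ℝ} (hP : ∀ a, 0 ≤ P a) {n : ℕ} (x : Fin n → X) :
    0 ≤ seqProb P x :=
  Finset.prod_nonneg fun _ _ => hP _

lemma sum_seqProb [Fintype X] (P : X → ℝ) (n : ℕ) : ∑ x : Fin n → X, seqProb P x = (∑ a, P a) ^ n := by
  have := Finset.prod_univ_sum (fun _ : Fin n => (Finset.univ : Finset X)) fun _ a => P a
  rw [Fintype.piFinset_univ] at this
  simpa [seqProb] using this.symm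

variable [DecidableEq X]

lemma empType_nonneg {n : ℕ} (x : Fin n → X) (a : X) : 0 ≤ empType x a :=
  div_nonneg (Finset.sum_nonneg fun _ _ => by split_ifs <;> norm_num) (Nat.cast_nonneg n)

lemma empType_apply_pos {n : ℕ} (x : Fin n → X) (i : Fin n) : 0 < empType x (x i) := by
  have hn : 0 < n := i.pos
  refine div_pos (Finset.sum_pos' (fun _ _ => by split_ifs <;> norm_num)
    ⟨i, Finset.mem_univ i, by simp⟩) (by exact_mod_cast hn)

/-- The number of occurrences of each letter. -/
def letterCount {n : ℕ} (x : Fin n → X) (a : X) : Fin (n + 1) :=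
  ⟨(Finset.univ.filter fun i => x i = a).card,
    Nat.lt_succ_of_le ((Finset.card_le_univ _).trans_eq (Fintype.card_fin n))⟩

lemma empType_eq_of_letterCount_eq {n : ℕ} {x y : Fin n → X} (h : letterCount x = letterCount y) :
    empType x = empType y := by
  funext a
  have := congrArg Fin.val (congrFun h a)
  simp only [letterCount] at this
  simp only [empType, Finset.sum_boole, this]

variable [Fintype X]

lemma sum_comp_eq {n : ℕ} (x : Fin n → X) (f : X → ℝ) :
    ∑ i, f (x i) = n * ∑ a, empType x a * f a := by
  rcases Nat.eq_zero_or_pos n with rfl | hn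
  · simp
  have hn' : (n : ℝ) ≠ 0 := by positivity
  have e : ∀ a, n * (empType x a * f a) = ∑ i, if x i = a then f a else 0 := fun a => by
    rw [empType, ← mul_assoc, mul_div_cancel₀ _ hn', Finset.sum_mul]
    exact Finset.sum_congr rfl fun i _ => by split_ifs <;> simp
  rw [Finset.mul_sum, Finset.sum_congr rfl fun a _ => e a, Finset.sum_comm]
  simp

lemma sum_empType {n : ℕ} (hn : n ≠ 0) (x : Fin n → X) : ∑ a, empType x a = 1 := by
  have := sum_comp_eq x fun _ => 1
  have hn' : (n : ℝ) ≠ 0 := by exact_mod_cast hn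
  simp only [Finset.sum_const, Finset.card_univ, Fintype.card_fin, nsmul_eq_mul, mul_one] at this
  exact (mul_left_cancel₀ hn' (by rw [← this, mul_one])).symm

lemma empType_mem {n : ℕ} (hn : n ≠ 0) (x : Fin n → X) : empType x ∈ stdSimplex ℝ X :=
  ⟨empType_nonneg x, sum_empType hn x⟩

/-- The log-likelihood ratio is linear in the type. Positivity is asked only at letters that occur,
so that `Q` may be the type of `x` itself. -/
lemma seqProb_eq_mul_exp {P Q : X → ℝ} {n : ℕ} (x : Fin n → X) (hP : ∀ i, 0 < P (x i))
    (hQ : ∀ i, 0 < Q (x i)) :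
    seqProb P x = seqProb Q x * Real.exp (-(n * ∑ a, empType x a * Real.log (Q a / P a))) := by
  rw [← sum_comp_eq x fun a => Real.log (Q a / P a), ← Finset.sum_neg_distrib, Real.exp_sum,
    seqProb, seqProb, ← Finset.prod_mul_distrib]
  refine Finset.prod_congr rfl fun i _ => ?_
  rw [← Real.log_inv, Real.exp_log (inv_pos.2 (div_pos (hQ i) (hP i))), inv_div,
    mul_div_cancel₀ _ (hQ i).ne']

lemma seqProb_eq_mul_exp_kl {P : X → ℝ} (hP : ∀ a, 0 < P a) {n : ℕ} (x : Fin n → X) :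
    seqProb P x = seqProb (empType x) x * Real.exp (-(n * kl (empType x) P)) :=
  seqProb_eq_mul_exp x (fun _ => hP _) (empType_apply_pos x)

/-- Under their own types, all sequences of length `n` have total mass at most the number of
types. -/
lemma sum_seqProb_empType_le (n : ℕ) :
    ∑ x : Fin n → X, seqProb (empType x) x ≤ ((n : ℝ) + 1) ^ Fintype.card X := by
  rw [← Finset.sum_fiberwise Finset.univ (letterCount (X := X) (n := n))]
  have : ∀ c : X → Fin (n + 1),
      ∑ x : Fin n → X with letterCount x = c, seqProb (empType x) x ≤ 1 := by
    intro c
    by_cases hc : ∃ x₀ : Fin n → X, letterCount x₀ = c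
    · obtain ⟨x₀, rfl⟩ := hc
      calc ∑ x : Fin n → X with letterCount x = letterCount x₀, seqProb (empType x) x
          = ∑ x : Fin n → X with letterCount x = letterCount x₀, seqProb (empType x₀) x :=
            Finset.sum_congr rfl fun x hx => by
              rw [empType_eq_of_letterCount_eq (Finset.mem_filter.1 hx).2]
        _ ≤ ∑ x : Fin n → X, seqProb (empType x₀) x :=
            Finset.sum_le_sum_of_subset_of_nonneg (Finset.filter_subset _ _)
              fun x _ _ => seqProb_nonneg (empType_nonneg x₀) x
        _ = 1 := by
            rw [sum_seqProb]
            -- For `n = 0` the type is the zero vector, but the total mass is a zeroth power, hence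
            -- 1.
            rcases eq_or_ne n 0 with rfl | hn
            · simp
            · rw [sum_empType hn, one_pow]
    · rw [Finset.filter_eq_empty_iff.2 fun x _ hx => hc ⟨x, hx⟩]
      simp
  refine (Finset.sum_le_sum fun c _ => this c).trans_eq ?_
  simp

open Classical in
lemma sum_seqProb_le_of_kl {P : X → ℝ} (hP : ∀ a, 0 < P a) {n : ℕ} (A : (Fin n → X) → Prop)
    {κ : ℝ} (h : ∀ x, A x → κ ≤ n * kl (empType x) P) :
    ∑ x, (if A x then seqProb P x else 0) ≤ Real.exp (-κ) * ((n : ℝ) + 1) ^ Fintype.card X := by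
  refine le_trans ?_ (mul_le_mul_of_nonneg_left (sum_seqProb_empType_le n) (Real.exp_nonneg _))
  rw [Finset.mul_sum]
  refine Finset.sum_le_sum fun x _ => ?_
  have h0 := seqProb_nonneg (empType_nonneg x) x
  split_ifs with hx
  · rw [seqProb_eq_mul_exp_kl hP, mul_comm]
    gcongr
    exact h x hx
  · positivity

open Classical in
/-- The probability that a pair of independent sequences, with independent samples of law `P` and
`Q`, satisfies `A`. -/
noncomputable def pairProb (P Q : X → ℝ) {N n : ℕ} (A : (Fin N → X) → (Fin n → X) → Prop) : ℝ :=
  ∑ x, ∑ y, if A x y then seqProb P x * seqProb Q y else 0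

/-- Sanov upper bound: relative to the product laws of their own types, pairs in `A` lose a factor
of at least e^(-κ), and those reference masses sum to at most the number of pairs of types. -/
lemma pairProb_le_of_kl {P Q : X → ℝ} (hP : ∀ a, 0 < P a) (hQ : ∀ a, 0 < Q a) {N n : ℕ}
    (A : (Fin N → X) → (Fin n → X) → Prop) {κ : ℝ}
    (h : ∀ x y, A x y → κ ≤ N * kl (empType x) P + n * kl (empType y) Q) :
    pairProb P Q A ≤
      Real.exp (-κ) * (((N : ℝ) + 1) ^ Fintype.card X * ((n : ℝ) + 1) ^ Fintype.card X) := by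
  have hs := mul_le_mul (sum_seqProb_empType_le (X := X) N) (sum_seqProb_empType_le (X := X) n)
    (Finset.sum_nonneg fun x _ => seqProb_nonneg (empType_nonneg x) x) (by positivity)
  refine le_trans ?_ (mul_le_mul_of_nonneg_left hs (Real.exp_nonneg _))
  rw [Finset.sum_mul_sum, Finset.mul_sum]
  refine Finset.sum_le_sum fun x _ => ?_
  rw [Finset.mul_sum]
  refine Finset.sum_le_sum fun y _ => ?_
  have h0 := seqProb_nonneg (empType_nonneg x) x
  have h1 := seqProb_nonneg (empType_nonneg y) y
  split_ifs with hxy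
  · rw [seqProb_eq_mul_exp_kl hP, seqProb_eq_mul_exp_kl hQ, mul_mul_mul_comm, ← Real.exp_add,
      mul_comm]
    gcongr
    linarith [h x y hxy]
  · positivity

/-- All letter frequencies are within `δ` of their expectations under `Q`. -/
def Typical (Q : X → ℝ) (δ : ℝ) {n : ℕ} (x : Fin n → X) : Prop :=
  ∀ a, |empType x a - Q a| ≤ δ

lemma eventually_pow_le_exp (m : ℕ) {c : ℝ} (hc : 0 < c) :
    ∀ᶠ n : ℕ in atTop, ((n : ℝ) + 1) ^ m ≤ Real.exp (c * n) := by
  -- The constant e^(-c) absorbs the shift from n + 1 to n in the exponent.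
  have h1 := (isLittleO_pow_exp_pos_mul_atTop m hc).bound (c := Real.exp (-c)) (Real.exp_pos _)
  have h2 : Tendsto (fun n : ℕ => (n : ℝ) + 1) atTop atTop :=
    tendsto_atTop_add_const_right _ _ tendsto_natCast_atTop_atTop
  filter_upwards [h2.eventually h1] with n hn
  rw [Real.norm_of_nonneg (by positivity), Real.norm_of_nonneg (by positivity),
    ← Real.exp_add] at hn
  exact hn.trans_eq (by congr 1; ring)

open Classical in
lemma eventually_half_le_sum_typical {Q : X → ℝ} (hQ : Q ∈ stdSimplex ℝ X) (pos : ∀ a, 0 < Q a)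
    {δ : ℝ} (hδ : 0 < δ) :
    ∀ᶠ n : ℕ in atTop,
      1 / 2 ≤ ∑ x : Fin n → X, (if Typical Q δ x then seqProb Q x else 0) := by
  have hc : 0 < δ ^ 2 / 8 := by positivity
  have h2 : ∀ᶠ n : ℕ in atTop, (2 : ℝ) ≤ Real.exp (δ ^ 2 / 8 * n) :=
    (Real.tendsto_exp_atTop.comp (tendsto_natCast_atTop_atTop.const_mul_atTop hc)).eventually_ge_atTop 2
  filter_upwards [eventually_pow_le_exp (Fintype.card X) hc, h2, eventually_ne_atTop 0]
    with n h1 h2 hn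
  -- An atypical letter forces divergence at least δ²/4. Half of this exponent beats the number of
  -- types, the other half makes the bound at most 1/2.
  have hle := sum_seqProb_le_of_kl pos (n := n) (fun x => ¬ Typical Q δ x)
    (κ := n * (δ ^ 2 / 4)) fun x hx => by
      obtain ⟨a, ha⟩ := not_forall.1 hx
      rw [not_le] at ha
      have e1 := sq_sub_le_hellinger (empType_mem hn x) hQ a
      have e2 := hellinger_le_kl (empType_mem hn x) hQ fun b h0 => absurd h0 (pos b).ne'
      have e3 : δ ^ 2 ≤ (empType x a - Q a) ^ 2 := by
        rw [← sq_abs (empType x a - Q a)]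
        gcongr
      gcongr
      linarith
  have htot : ∑ x : Fin n → X, (if Typical Q δ x then seqProb Q x else 0) +
      ∑ x : Fin n → X, (if Typical Q δ x then 0 else seqProb Q x) = 1 := by
    rw [← Finset.sum_add_distrib, ← one_pow n, ← hQ.2, ← sum_seqProb]
    exact Finset.sum_congr rfl fun x _ => by by_cases h : Typical Q δ x <;> simp [h]
  have hsmall : Real.exp (-(n * (δ ^ 2 / 4))) * ((n : ℝ) + 1) ^ Fintype.card X ≤ 1 / 2 := by
    have e1 : Real.exp (-(n * (δ ^ 2 / 4))) =
        (Real.exp (δ ^ 2 / 8 * n))⁻¹ * (Real.exp (δ ^ 2 / 8 * n))⁻¹ := by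
      rw [← Real.exp_neg, ← Real.exp_add]
      congr 1
      ring
    rw [e1]
    calc _ ≤ (Real.exp (δ ^ 2 / 8 * n))⁻¹ * (Real.exp (δ ^ 2 / 8 * n))⁻¹ *
          Real.exp (δ ^ 2 / 8 * n) := by gcongr
      _ = (Real.exp (δ ^ 2 / 8 * n))⁻¹ := by field_simp
      _ ≤ 2⁻¹ := by gcongr
      _ = 1 / 2 := by norm_num
  have hle' : ∑ x : Fin n → X, (if Typical Q δ x then 0 else seqProb Q x) ≤ 1 / 2 := by
    refine le_trans (Finset.sum_le_sum fun x _ => ?_) (hle.trans hsmall)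
    by_cases h : Typical Q δ x <;> simp [h]
  linarith

lemma Typical.mul_exp_le_seqProb {P Q : X → ℝ} (hP : ∀ a, 0 < P a) (hQ : ∀ a, 0 < Q a) {δ : ℝ}
    {n : ℕ} {x : Fin n → X} (hx : Typical Q δ x) :
    seqProb Q x * Real.exp (-(n * (kl Q P + δ * ∑ a, |Real.log (Q a / P a)|))) ≤
      seqProb P x := by
  rw [seqProb_eq_mul_exp x (fun _ => hP _) (fun _ => hQ _)]
  have h0 := seqProb_nonneg (fun a => (hQ a).le) x
  gcongr
  rw [kl, Finset.mul_sum, ← Finset.sum_add_distrib]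
  refine Finset.sum_le_sum fun a _ => ?_
  have := (le_abs_self _).trans_eq (abs_mul (empType x a - Q a) (Real.log (Q a / P a)))
  have := this.trans (mul_le_mul_of_nonneg_right (hx a) (abs_nonneg _))
  linarith

/-- Change of measure: lower bound for the probability of an event that contains all pairs of
sequences which are typical for `Q₁` and `Q₂`. -/
lemma eventually_le_pairProb {P₁ P₂ Q₁ Q₂ : X → ℝ} (pos₁ : ∀ a, 0 < P₁ a) (pos₂ : ∀ a, 0 < P₂ a)
    (hQ₁ : Q₁ ∈ stdSimplex ℝ X) (hQ₂ : Q₂ ∈ stdSimplex ℝ X) (qos₁ : ∀ a, 0 < Q₁ a)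
    (qos₂ : ∀ a, 0 < Q₂ a) {δ : ℝ} (hδ : 0 < δ) {n : ℕ → ℕ} (hn : Tendsto n atTop atTop)
    (A : ∀ N, (Fin N → X) → (Fin (n N) → X) → Prop)
    (hA : ∀ N x y, Typical Q₁ δ x → Typical Q₂ δ y → A N x y) :
    ∀ᶠ N : ℕ in atTop,
      1 / 4 * Real.exp (-(N * (kl Q₁ P₁ + δ * ∑ a, |Real.log (Q₁ a / P₁ a)|)
        + n N * (kl Q₂ P₂ + δ * ∑ a, |Real.log (Q₂ a / P₂ a)|))) ≤ pairProb P₁ P₂ (A N) := by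
  classical
  filter_upwards [eventually_half_le_sum_typical hQ₁ qos₁ hδ,
    hn.eventually (eventually_half_le_sum_typical hQ₂ qos₂ hδ)] with N h₁ h₂
  set c₁ := kl Q₁ P₁ + δ * ∑ a, |Real.log (Q₁ a / P₁ a)|
  set c₂ := kl Q₂ P₂ + δ * ∑ a, |Real.log (Q₂ a / P₂ a)|
  have key := mul_le_mul_of_nonneg_right (mul_le_mul h₁ h₂ (by norm_num) (by linarith))
    (Real.exp_nonneg (-(N * c₁ + n N * c₂)))
  rw [show (1 / 2 * (1 / 2) : ℝ) = 1 / 4 by norm_num] at key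
  refine key.trans ?_
  rw [Finset.sum_mul_sum, Finset.sum_mul]
  refine Finset.sum_le_sum fun x _ => ?_
  rw [Finset.sum_mul]
  refine Finset.sum_le_sum fun y _ => ?_
  have p₁ := seqProb_nonneg (fun a => (pos₁ a).le) x
  have p₂ := seqProb_nonneg (fun a => (pos₂ a).le) y
  have q₂ := seqProb_nonneg (fun a => (qos₂ a).le) y
  by_cases hx : Typical Q₁ δ x
  · by_cases hy : Typical Q₂ δ y
    · rw [if_pos hx, if_pos hy, if_pos (hA N x y hx hy), neg_add, Real.exp_add, mul_mul_mul_comm]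
      exact mul_le_mul (hx.mul_exp_le_seqProb pos₁ qos₁) (hy.mul_exp_le_seqProb pos₂ qos₂)
        (mul_nonneg q₂ (Real.exp_nonneg _)) p₁
    · rw [if_neg hy, mul_zero, zero_mul]
      split_ifs <;> positivity
  · rw [if_neg hx, zero_mul, zero_mul]
    split_ifs <;> positivity

end

section

variable {X : Type*}

/-! ### The law of the data -/

lemma vec_mem [Fintype X] (P : PMF X) : vec P ∈ stdSimplex ℝ X := by
  refine ⟨fun a => ENNReal.toReal_nonneg, ?_⟩
  simp only [vec]
  rw [← ENNReal.toReal_sum fun a _ => P.apply_ne_top a, ← tsum_fintype (L := .unconditional X),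
    P.tsum_coe, ENNReal.toReal_one]

lemma vec_pos {P : PMF X} (hP : ∀ a, P a ≠ 0) (a : X) : 0 < vec P a :=
  ENNReal.toReal_pos (hP a) (P.apply_ne_top a)

variable [MeasurableSpace X]

lemma measurable_prefix (n : ℕ) : Measurable fun (y : ℕ → X) (k : Fin n) => y k :=
  measurable_pi_lambda _ fun _ => measurable_pi_apply _

lemma map_prefix_infinitePi (P : PMF X) (n : ℕ) :
    (Measure.infinitePi fun _ : ℕ => P.toMeasure).map (fun y (k : Fin n) => y k) =
      Measure.pi fun _ => P.toMeasure := by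
  refine (Measure.pi_eq fun s hs => ?_).symm
  rw [Measure.map_apply (measurable_prefix n) (MeasurableSet.univ_pi hs)]
  set t : ℕ → Set X := fun k => if h : k < n then s ⟨k, h⟩ else Set.univ with ht
  have e : (fun (y : ℕ → X) (k : Fin n) => y k) ⁻¹' Set.univ.pi s =
      (↑(Finset.range n) : Set ℕ).pi t := by
    ext y
    simp only [Set.mem_preimage, Set.mem_pi, Set.mem_univ, true_imp_iff, Finset.coe_range,
      Set.mem_Iio, ht]
    constructor
    · intro h k hk
      rw [dif_pos hk]
      exact h ⟨k, hk⟩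
    · intro h k
      have := h k k.2
      rwa [dif_pos k.2] at this
  rw [e, Measure.infinitePi_pi, Finset.prod_range]
  · exact Finset.prod_congr rfl fun k _ => by simp [ht]
  · intro k hk
    simp only [ht]
    split_ifs with h
    · exact hs _
    · exact MeasurableSet.univ

lemma map_law (P₁ P₂ : PMF X) (N n : ℕ) (i j : Hyp) :
    MeasurePreserving
      (fun s : (Fin N → X) × (Fin N → X) × (ℕ → X) =>
        ((toData s).train i, (toData s).prefix n))
      (law P₁ P₂ N j)
      ((Measure.pi fun _ => (source P₁ P₂ i).toMeasure).prod
        (Measure.pi fun _ => (source P₁ P₂ j).toMeasure)) := by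
  have hpre : MeasurePreserving (fun (y : ℕ → X) (k : Fin n) => y k)
      (Measure.infinitePi fun _ => (source P₁ P₂ j).toMeasure)
      (Measure.pi fun _ => (source P₁ P₂ j).toMeasure) :=
    ⟨measurable_prefix n, map_prefix_infinitePi _ n⟩
  cases i with
  | H₁ => exact (MeasurePreserving.id _).prod (hpre.comp measurePreserving_snd)
  | H₂ => exact ((MeasurePreserving.id _).prod hpre).comp measurePreserving_snd

variable [Fintype X] [MeasurableSingletonClass X]

lemma pi_toMeasure_singleton (P : PMF X) {n : ℕ} (x : Fin n → X) :
    (Measure.pi fun _ : Fin n => P.toMeasure) {x} = ENNReal.ofReal (seqProb (vec P) x) := by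
  rw [Measure.pi_singleton, seqProb,
    ENNReal.ofReal_prod_of_nonneg fun _ _ => (vec_mem P).1 _]
  refine Finset.prod_congr rfl fun k _ => ?_
  rw [P.toMeasure_apply_singleton _ (measurableSet_singleton _), vec,
    ENNReal.ofReal_toReal (P.apply_ne_top _)]

/-- The probability of an event that involves one training sequence and finitely many test
samples. -/
lemma law_apply_eq_pairProb [DecidableEq X] (P₁ P₂ : PMF X) (N n : ℕ) (i j : Hyp)
    (A : (Fin N → X) → (Fin n → X) → Prop) :
    law P₁ P₂ N j {s | A ((toData s).train i) ((toData s).prefix n)} =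
      ENNReal.ofReal (pairProb (vec (source P₁ P₂ i)) (vec (source P₁ P₂ j)) A) := by
  classical
  set B : Finset ((Fin N → X) × (Fin n → X)) := Finset.univ.filter fun z => A z.1 z.2 with hB
  have hpre : {s : (Fin N → X) × (Fin N → X) × (ℕ → X) |
      A ((toData s).train i) ((toData s).prefix n)} =
      (fun s => ((toData s).train i, (toData s).prefix n)) ⁻¹' (B : Set _) := by
    ext s
    simp [hB]
  have h0 : ∀ x y, 0 ≤ seqProb (vec (source P₁ P₂ i)) (n := N) x *
      seqProb (vec (source P₁ P₂ j)) (n := n) y := fun x y =>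
    mul_nonneg (seqProb_nonneg (vec_mem _).1 x) (seqProb_nonneg (vec_mem _).1 y)
  rw [hpre, (map_law P₁ P₂ N n i j).measure_preimage B.measurableSet.nullMeasurableSet,
    ← sum_measure_singleton, hB, Finset.sum_filter, Fintype.sum_prod_type, pairProb,
    ENNReal.ofReal_sum_of_nonneg fun x _ => Finset.sum_nonneg fun y _ => by
      split_ifs
      · exact h0 x y
      · exact le_rfl]
  refine Finset.sum_congr rfl fun x _ => ?_
  rw [ENNReal.ofReal_sum_of_nonneg fun y _ => by
      split_ifs
      · exact h0 x y
      · exact le_rfl]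
  refine Finset.sum_congr rfl fun y _ => ?_
  split_ifs with hxy
  · rw [← Set.singleton_prod_singleton, Measure.prod_prod, pi_toMeasure_singleton,
      pi_toMeasure_singleton, ENNReal.ofReal_mul (seqProb_nonneg (vec_mem _).1 x)]
  · simp

end

section

/-! ### Error exponents -/

lemma le_neg_log_div {x : ENNReal} {d : ℝ} {N : ℕ} (hN : N ≠ 0)
    (h : x ≤ ENNReal.ofReal (Real.exp (-(d * N)))) :
    (d : EReal) ≤ -ENNReal.log x / (N : EReal) := by
  have hN' : (0 : EReal) < N := by exact_mod_cast Nat.pos_of_ne_zero hN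
  rw [EReal.le_div_iff_mul_le hN' (EReal.natCast_ne_top N)]
  refine EReal.le_neg_of_le_neg ?_
  have h1 := ENNReal.log_le_log h
  rw [ENNReal.log_ofReal_of_pos (Real.exp_pos _), Real.log_exp] at h1
  exact_mod_cast h1

lemma neg_log_div_le {x : ENNReal} {d : ℝ} {N : ℕ} (hN : N ≠ 0)
    (h : ENNReal.ofReal (Real.exp (-(d * N))) ≤ x) :
    -ENNReal.log x / (N : EReal) ≤ (d : EReal) := by
  have hN' : (0 : EReal) < N := by exact_mod_cast Nat.pos_of_ne_zero hN
  rw [EReal.div_le_iff_le_mul hN' (EReal.natCast_ne_top N), mul_comm]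
  refine EReal.neg_le_of_neg_le ?_
  have h1 := ENNReal.log_le_log h
  rw [ENNReal.log_ofReal_of_pos (Real.exp_pos _), Real.log_exp] at h1
  exact_mod_cast h1

variable {X : Type*}

lemma bayesErr_le [MeasurableSpace X] (P₁ P₂ : PMF X) {p : ℝ} (hp : p ∈ Set.Ioo (0 : ℝ) 1)
    {N : ℕ} (Φ : Test X N) {c : ENNReal} (h : ∀ i, errProb P₁ P₂ Φ i ≤ c) :
    bayesErr P₁ P₂ p Φ ≤ c := by
  calc bayesErr P₁ P₂ p Φ ≤ ENNReal.ofReal p * c + ENNReal.ofReal (1 - p) * c := by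
        unfold bayesErr
        gcongr
        · exact h _
        · exact h _
    _ = c := by
        rw [← add_mul, ← ENNReal.ofReal_add hp.1.le (by linarith [hp.2])]
        simp

variable [Fintype X]

/-! ### Chernoff information -/

lemma exists_chernoff_le {P Q : X → ℝ} (hP : P ∈ stdSimplex ℝ X) (hQ : Q ∈ stdSimplex ℝ X)
    (posP : ∀ a, 0 < P a) (posQ : ∀ a, 0 < Q a) (hC : 0 < chernoff P Q) :
    ∃ η ∈ Set.Ioo (0 : ℝ) 1, ∀ R ∈ stdSimplex ℝ X,
      chernoff P Q ≤ η * kl R P + (1 - η) * kl R Q := by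
  set Z : ℝ → ℝ := fun η => ∑ a, P a ^ η * Q a ^ (1 - η) with hZ
  have hne : (Finset.univ : Finset X).Nonempty := by
    by_contra hc
    have := hP.2
    rw [Finset.not_nonempty_iff_eq_empty.1 hc] at this
    simp at this
  have hterm : ∀ (η : ℝ) a, 0 < P a ^ η * Q a ^ (1 - η) := fun η a =>
    mul_pos (Real.rpow_pos_of_pos (posP a) _) (Real.rpow_pos_of_pos (posQ a) _)
  have hZpos : ∀ η, 0 < Z η := fun η => Finset.sum_pos (fun a _ => hterm η a) hne
  have hcont : Continuous fun η => Real.log (Z η) := by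
    refine Continuous.log ?_ fun η => (hZpos η).ne'
    refine continuous_finsetSum _ fun a _ => ?_
    exact (continuous_const.rpow continuous_id fun _ => Or.inl (posP a).ne').mul
      (continuous_const.rpow (continuous_const.sub continuous_id) fun _ => Or.inl (posQ a).ne')
  obtain ⟨η, hη, hmin⟩ := (isCompact_Icc (a := (0 : ℝ)) (b := 1)).exists_isMinOn
    (Set.nonempty_Icc.2 zero_le_one) hcont.continuousOn
  have hCη : chernoff P Q = -Real.log (Z η) := by
    have : IsLeast ((fun η => Real.log (Z η)) '' Set.Icc 0 1) (Real.log (Z η)) :=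
      ⟨⟨η, hη, rfl⟩, by rintro _ ⟨u, hu, rfl⟩; exact hmin hu⟩
    rw [chernoff, this.csInf_eq]
  -- At either endpoint the sum is 1 and the Chernoff information would vanish.
  have h0 : η ≠ 0 := by
    rintro rfl
    have : Z 0 = 1 := by simp [hZ, hQ.2]
    rw [hCη, this] at hC
    simp at hC
  have h1 : η ≠ 1 := by
    rintro rfl
    have : Z 1 = 1 := by simp [hZ, hP.2]
    rw [hCη, this] at hC
    simp at hC
  refine ⟨η, ⟨lt_of_le_of_ne hη.1 (Ne.symm h0), lt_of_le_of_ne hη.2 h1⟩, fun R hR => ?_⟩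
  -- The tilted law turns the weighted sum of divergences into D(R‖G) - log Z(η), at least the
  -- Chernoff information.
  set G : X → ℝ := fun a => P a ^ η * Q a ^ (1 - η) / Z η with hG
  have hGpos : ∀ a, 0 < G a := fun a => div_pos (hterm η a) (hZpos η)
  have hGmem : G ∈ stdSimplex ℝ X :=
    ⟨fun a => (hGpos a).le, by rw [hG, ← Finset.sum_div]; exact div_self (hZpos η).ne'⟩
  have hk := kl_nonneg_of_pos hR hGmem hGpos
  have e : η * kl R P + (1 - η) * kl R Q = kl R G + -Real.log (Z η) := by
    have hs : -Real.log (Z η) = ∑ a, R a * -Real.log (Z η) := by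
      rw [← Finset.sum_mul, hR.2, one_mul]
    rw [hs]
    simp only [kl, Finset.mul_sum, ← Finset.sum_add_distrib]
    refine Finset.sum_congr rfl fun a _ => ?_
    by_cases hr : R a = 0
    · simp [hr]
    rw [Real.log_div hr (posP a).ne', Real.log_div hr (posQ a).ne', Real.log_div hr (hGpos a).ne',
      hG, Real.log_div (hterm η a).ne' (hZpos η).ne',
      Real.log_mul (Real.rpow_pos_of_pos (posP a) _).ne' (Real.rpow_pos_of_pos (posQ a) _).ne',
      Real.log_rpow (posP a), Real.log_rpow (posQ a)]
    ring
  rw [e, hCη]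
  linarith

/-! ### The sequential test -/

lemma kl_le_kl_add_of_le {Q M P : X → ℝ} (hQ : Q ∈ stdSimplex ℝ X) (hM : ∀ a, 0 ≤ M a)
    (h : ∀ a, M a = 0 → Q a = 0) (hP : ∀ a, 0 < P a) {c : ℝ}
    (hle : ∀ a, M a ≤ P a * Real.exp c) : kl Q P ≤ kl Q M + c := by
  rw [← one_mul c, ← hQ.2, Finset.sum_mul, kl, kl, ← Finset.sum_add_distrib]
  refine Finset.sum_le_sum fun a _ => ?_
  by_cases hq : Q a = 0
  · simp [hq]
  have hm : 0 < M a := lt_of_le_of_ne (hM a) fun h0 => hq (h a h0.symm)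
  have h1 := Real.log_le_log hm (hle a)
  rw [Real.log_mul (hP a).ne' (Real.exp_pos c).ne', Real.log_exp] at h1
  rw [Real.log_div hq (hP a).ne', Real.log_div hq hm.ne', ← mul_add]
  exact mul_le_mul_of_nonneg_left (by linarith) (hQ.1 a)

/-- If `R` is the type of `N ^ 2` test samples of law `P` and `Q` that of `N` training samples of
law `P'`, then a score below `γ N` is exponentially unlikely with exponent at least `γ - ε`. -/
lemma eventually_le_of_score_lt {P P' : X → ℝ} (hP : P ∈ stdSimplex ℝ X)
    (hP' : P' ∈ stdSimplex ℝ X) (pos : ∀ a, 0 < P a) (pos' : ∀ a, 0 < P' a) {C γ η : ℝ}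
    (hγ : 0 < γ) (hγC : γ ≤ C) (hη : η ∈ Set.Ioo (0 : ℝ) 1)
    (hC : ∀ Q ∈ stdSimplex ℝ X, C ≤ η * kl Q P + (1 - η) * kl Q P') {ε : ℝ} (hε : 0 < ε) :
    ∀ᶠ N : ℕ in atTop, ∀ Q ∈ stdSimplex ℝ X, ∀ R ∈ stdSimplex ℝ X,
      ((N ^ 2 : ℕ) : ℝ) * gjs Q R ((N : ℝ) / (N ^ 2 : ℕ)) < γ * N →
        (γ - ε) * N ≤ N * kl Q P' + ((N ^ 2 : ℕ) : ℝ) * kl R P := by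
  -- Calibrated so that D(Q‖P) ≤ γ + c and the Chernoff inequality give D(Q‖P') ≥ γ - ηε.
  set c := (1 - η) * ε with hc
  have hη1 : 0 < 1 - η := by linarith [hη.2]
  have hc0 : 0 < c := mul_pos hη1 hε
  have hlim : Tendsto (fun N : ℕ => 2 * √(γ / N) + 1 / (N : ℝ)) atTop (𝓝 0) := by
    have h1 : Tendsto (fun N : ℕ => γ / (N : ℝ)) atTop (𝓝 0) :=
      tendsto_const_nhds.div_atTop tendsto_natCast_atTop_atTop
    have h2 := (Real.continuous_sqrt.tendsto 0).comp h1
    rw [Real.sqrt_zero] at h2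
    simpa using (h2.const_mul 2).add (tendsto_one_div_atTop_nhds_zero_nat (𝕜 := ℝ))
  have hsmall : ∀ᶠ N : ℕ in atTop, ∀ a,
      2 * √(γ / N) + 1 / (N : ℝ) < P a * (Real.exp c - 1) :=
    eventually_all.2 fun a => hlim.eventually_lt_const
      (mul_pos (pos a) (by linarith [Real.one_lt_exp_iff.2 hc0]))
  filter_upwards [hsmall, eventually_ne_atTop 0] with N hN hN0 Q hQ R hR hlt
  have hNpos : (0 : ℝ) < N := by exact_mod_cast Nat.pos_of_ne_zero hN0
  have hα : (N : ℝ) / (N ^ 2 : ℕ) = 1 / N := by push_cast; field_simp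
  rw [hα] at hlt
  push_cast at hlt ⊢
  have hα0 : (0 : ℝ) < 1 / N := by positivity
  have hM := mix_mem hQ hR hα0
  have nR := kl_nonneg_of_pos hR hP pos
  have nQ := kl_nonneg_of_pos hQ hP' pos'
  -- If N·D(R‖P) ≥ γ, the N² test samples alone supply the exponent. Otherwise `R` is within 2√(γ/N)
  -- of `P` from above, and so is the mixture up to 1/N.
  by_cases hD : γ ≤ N * kl R P
  · nlinarith [mul_nonneg hNpos.le nQ, mul_pos hNpos hε]
  push Not at hD
  have hkM : kl Q (mix Q R (1 / N)) < γ := by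
    have h1 := kl_nonneg hR hM fun a h0 => (mix_eq_zero hQ.1 hR.1 hα0 h0).2
    have h2 : (N : ℝ) ^ 2 * gjs Q R (1 / N) =
        N * kl Q (mix Q R (1 / N)) + N ^ 2 * kl R (mix Q R (1 / N)) := by
      rw [gjs]; field_simp
    rw [h2] at hlt
    have h3 : 0 ≤ (N : ℝ) ^ 2 * kl R (mix Q R (1 / N)) := by positivity
    nlinarith
  have hMle : ∀ a, mix Q R (1 / N) a ≤ P a * Real.exp c := fun a => by
    have h1 := (sq_sub_le_hellinger hR hP a).trans
      (mul_le_mul_of_nonneg_left (hellinger_le_kl hR hP fun b h0 => absurd h0 (pos b).ne')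
        (by norm_num : (0 : ℝ) ≤ 4))
    have h2 : kl R P ≤ γ / N := by
      rw [le_div_iff₀ hNpos]
      linarith
    have h3 : R a - P a ≤ 2 * √(γ / N) := by
      have : (R a - P a) ^ 2 ≤ (2 * √(γ / N)) ^ 2 := by
        rw [mul_pow, Real.sq_sqrt (by positivity)]
        linarith
      exact le_of_sq_le_sq this (by positivity)
    have hQ1 : Q a ≤ 1 :=
      (Finset.single_le_sum (fun b _ => hQ.1 b) (Finset.mem_univ a)).trans hQ.2.le
    have h4 : mix Q R (1 / N) a ≤ 1 / N + R a := by
      rw [mix, div_le_iff₀ (by positivity)]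
      have := hR.1 a
      have h5 : (1 / N : ℝ) * Q a ≤ 1 / N := mul_le_of_le_one_right hα0.le hQ1
      have h6 : 0 ≤ (1 / N + R a) * (1 / N : ℝ) := by positivity
      linarith
    linarith [hN a]
  have hkP := kl_le_kl_add_of_le hQ hM.1 (fun a h0 => (mix_eq_zero hQ.1 hR.1 hα0 h0).1) pos hMle
  have h4 := hC Q hQ
  have h5 : γ - ε ≤ kl Q P' := by
    have h6 : (1 - η) * (γ - η * ε) ≤ (1 - η) * kl Q P' := by
      have : η * kl Q P ≤ η * (γ + c) := mul_le_mul_of_nonneg_left (by linarith) hη.1.le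
      rw [hc] at this
      nlinarith
    have := le_of_mul_le_mul_left h6 hη1
    nlinarith [mul_pos hη1 hε]
  have : 0 ≤ (N : ℝ) ^ 2 * kl R P := by positivity
  nlinarith

variable [DecidableEq X]

/-- If score `i` is below threshold at the stopping time, a wrong decision excludes that score `j`
has reached it; so neither has, and only the cap `N ^ 2` can have stopped the test. Arbitrary
decisions are covered, since both scores reaching the threshold falls under the first alternative.
-/
lemma IsSeqTest.score_of_ne {N : ℕ} (hN : N ≠ 0) {γ : ℝ} {Φ : Test X N} (h : IsSeqTest γ Φ)
    {i j : Hyp} (hij : i ≠ j) {ω : Data X N} (hd : Φ.d ω ≠ i) :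
    (∃ n ∈ Finset.Icc 1 (N ^ 2), γ * N ≤ score i n ω) ∨ score j (N ^ 2) ω < γ * N := by
  obtain ⟨hT, hd₁, hd₂⟩ := h ω
  have hmem : Φ.T ω ∈ {n : ℕ | 1 ≤ n ∧ ∃ i : Hyp, γ * N ≤ score i n ω} ∪ {N ^ 2} := by
    rw [hT]
    exact Nat.sInf_mem ⟨N ^ 2, Or.inr rfl⟩
  have hle : Φ.T ω ≤ N ^ 2 := by
    rw [hT]
    exact Nat.sInf_le (Or.inr rfl)
  have hT1 : 1 ≤ Φ.T ω := by
    rcases hmem with hm | hm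
    · exact hm.1
    · rw [Set.mem_singleton_iff.1 hm]
      exact Nat.one_le_iff_ne_zero.2 (pow_ne_zero 2 hN)
  by_cases hi : γ * N ≤ score i (Φ.T ω) ω
  · exact Or.inl ⟨_, Finset.mem_Icc.2 ⟨hT1, hle⟩, hi⟩
  right
  push Not at hi
  have hj : score j (Φ.T ω) ω < γ * N := by
    by_contra! hj
    cases i <;> cases j
    · exact hij rfl
    · exact hd (hd₁ hj hi)
    · exact hd (hd₂ hj hi)
    · exact hij rfl
  rcases hmem with ⟨-, k, hk⟩ | hm
  · exfalso
    have : k = i ∨ k = j := by cases i <;> cases j <;> cases k <;> simp_all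
    rcases this with rfl | rfl <;> linarith
  · rwa [Set.mem_singleton_iff.1 hm] at hj

variable [MeasurableSpace X] [MeasurableSingletonClass X]

lemma eventually_errProb_seq_le (P₁ P₂ : PMF X) (hP₁ : ∀ a, P₁ a ≠ 0) (hP₂ : ∀ a, P₂ a ≠ 0)
    {γ : ℝ} (hγ : γ ∈ Set.Ioc 0 (chernoff (vec P₁) (vec P₂))) {Φ : ∀ N : ℕ, Test X N}
    (hΦ : ∀ N, IsSeqTest γ (Φ N)) (i : Hyp) {d : ℝ} (hd : d < γ) :
    ∀ᶠ N : ℕ in atTop,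
      errProb P₁ P₂ (Φ N) i ≤ ENNReal.ofReal (Real.exp (-(d * N))) := by
  obtain ⟨η, hη, hC⟩ := exists_chernoff_le (vec_mem P₁) (vec_mem P₂) (vec_pos hP₁) (vec_pos hP₂)
    (hγ.1.trans_le hγ.2)
  obtain ⟨j, hij⟩ : ∃ j : Hyp, i ≠ j := by
    cases i
    · exact ⟨.H₂, by simp⟩
    · exact ⟨.H₁, by simp⟩
  have hpos : ∀ k a, 0 < vec (source P₁ P₂ k) a := fun k => by
    cases k
    · exact vec_pos hP₁
    · exact vec_pos hP₂
  obtain ⟨η', hη', hC'⟩ : ∃ η' ∈ Set.Ioo (0 : ℝ) 1, ∀ R ∈ stdSimplex ℝ X,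
      chernoff (vec P₁) (vec P₂) ≤
        η' * kl R (vec (source P₁ P₂ i)) + (1 - η') * kl R (vec (source P₁ P₂ j)) := by
    cases i <;> cases j
    · exact absurd rfl hij
    · exact ⟨η, hη, hC⟩
    · refine ⟨1 - η, ⟨by linarith [hη.2], by linarith [hη.1]⟩, fun R hR => (hC R hR).trans_eq ?_⟩
      simp only [source]
      ring
    · exact absurd rfl hij
  set P := vec (source P₁ P₂ i) with hP
  set P' := vec (source P₁ P₂ j) with hP'
  have hPmem : P ∈ stdSimplex ℝ X := vec_mem _
  set ε := (γ - d) / 2 with hε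
  have hε0 : 0 < ε := by linarith
  set k := Fintype.card X with hk
  -- Power count: `k` for the training types, `2 * k` for the types of up to `N ^ 2` test samples,
  -- and 2 for the union over `N ^ 2 + 1` events.
  filter_upwards [eventually_le_of_score_lt hPmem (vec_mem _) (hpos i) (hpos j) hγ.1 hγ.2 hη' hC'
    hε0, eventually_pow_le_exp (3 * k + 2) hε0, eventually_ne_atTop 0] with N h₁ h₂ hN
  set B : ℝ := Real.exp (-((γ - ε) * N)) * ((N : ℝ) + 1) ^ (3 * k) with hB
  have hB0 : 0 ≤ B := by positivity
  have hN2 : N ^ 2 ≠ 0 := pow_ne_zero 2 hN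
  have hNpos : (0 : ℝ) < N := by exact_mod_cast Nat.pos_of_ne_zero hN
  have hpoly : ∀ m ≤ N ^ 2, ∀ κ : ℝ, (γ - ε) * N ≤ κ →
      Real.exp (-κ) * (((N : ℝ) + 1) ^ k * ((m : ℝ) + 1) ^ k) ≤ B := by
    intro m hm κ hκ
    have hm' : (m : ℝ) + 1 ≤ ((N : ℝ) + 1) ^ 2 := by
      have : (m : ℝ) ≤ (N : ℝ) ^ 2 := by exact_mod_cast hm
      nlinarith
    rw [hB]
    gcongr
    calc ((N : ℝ) + 1) ^ k * ((m : ℝ) + 1) ^ k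
        ≤ ((N : ℝ) + 1) ^ k * (((N : ℝ) + 1) ^ 2) ^ k := by gcongr
      _ = ((N : ℝ) + 1) ^ (3 * k) := by
          rw [← pow_mul, ← pow_add]
          congr 1
          ring
  have hE₁ : ∀ m ∈ Finset.Icc 1 (N ^ 2),
      law P₁ P₂ N i {s | γ * N ≤ score i m (toData s)} ≤ ENNReal.ofReal B := by
    intro m hm
    rw [Finset.mem_Icc] at hm
    have hm0 : m ≠ 0 := by omega
    have hmpos : (0 : ℝ) < m := by exact_mod_cast Nat.pos_of_ne_zero hm0
    refine (law_apply_eq_pairProb P₁ P₂ N m i i fun x y =>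
      γ * N ≤ m * gjs (empType x) (empType y) ((N : ℝ) / m)).trans_le ?_
    refine ENNReal.ofReal_le_ofReal (le_trans (pairProb_le_of_kl (hpos i) (hpos i) _
      (κ := γ * N) fun x y hxy => ?_) (hpoly m hm.2 _ (by nlinarith)))
    refine hxy.trans ?_
    have := mul_le_mul_of_nonneg_left (gjs_le (empType_mem hN x) (empType_mem hm0 y) hPmem
      (fun a h0 => absurd h0 (hpos i a).ne') (fun a h0 => absurd h0 (hpos i a).ne')
      (div_pos hNpos hmpos)) hmpos.le
    refine this.trans_eq ?_
    field_simp
    rfl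
  have hE₂ : law P₁ P₂ N i {s | score j (N ^ 2) (toData s) < γ * N} ≤ ENNReal.ofReal B := by
    refine (law_apply_eq_pairProb P₁ P₂ N (N ^ 2) j i fun x y =>
      ((N ^ 2 : ℕ) : ℝ) * gjs (empType x) (empType y) ((N : ℝ) / (N ^ 2 : ℕ)) < γ * N).trans_le ?_
    exact ENNReal.ofReal_le_ofReal (le_trans (pairProb_le_of_kl (hpos j) (hpos i) _
      (κ := (γ - ε) * N) fun x y hxy => h₁ _ (empType_mem hN x) _ (empType_mem hN2 y) hxy)
      (hpoly _ le_rfl _ le_rfl))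
  have hsub : {s | (Φ N).d (toData s) ≠ i} ⊆
      (⋃ m ∈ Finset.Icc 1 (N ^ 2), {s | γ * N ≤ score i m (toData s)}) ∪
        {s | score j (N ^ 2) (toData s) < γ * N} := by
    intro s hs
    rcases (hΦ N).score_of_ne hN hij hs with ⟨m, hm, h⟩ | h
    · exact Or.inl (Set.mem_biUnion hm h)
    · exact Or.inr h
  calc errProb P₁ P₂ (Φ N) i
      ≤ ∑ m ∈ Finset.Icc 1 (N ^ 2), law P₁ P₂ N i {s | γ * N ≤ score i m (toData s)} +
        law P₁ P₂ N i {s | score j (N ^ 2) (toData s) < γ * N} :=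
        (measure_mono hsub).trans ((measure_union_le _ _).trans
          (add_le_add_left (measure_biUnion_finset_le _ _) _))
    _ ≤ ∑ m ∈ Finset.Icc 1 (N ^ 2), ENNReal.ofReal B + ENNReal.ofReal B :=
        add_le_add (Finset.sum_le_sum hE₁) hE₂
    _ = ENNReal.ofReal (((N : ℝ) ^ 2 + 1) * B) := by
        rw [Finset.sum_const, Nat.card_Icc, nsmul_eq_mul, add_mul, one_mul,
          ENNReal.ofReal_add (by positivity) hB0,
          ENNReal.ofReal_mul (p := (N : ℝ) ^ 2) (by positivity)]
        congr 2
        rw [add_tsub_cancel_right, ← ENNReal.ofReal_natCast]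
        push_cast
        rfl
    _ ≤ ENNReal.ofReal (Real.exp (-(d * N))) := by
        refine ENNReal.ofReal_le_ofReal ?_
        calc ((N : ℝ) ^ 2 + 1) * B ≤ ((N : ℝ) + 1) ^ 2 * B := by
              gcongr
              nlinarith
          _ = Real.exp (-((γ - ε) * N)) * ((N : ℝ) + 1) ^ (3 * k + 2) := by rw [hB]; ring
          _ ≤ Real.exp (-((γ - ε) * N)) * Real.exp (ε * N) := by gcongr
          _ = Real.exp (-(d * N)) := by
              rw [← Real.exp_add]
              congr 1
              rw [hε]
              ring

lemma le_bayesExponent_seq (P₁ P₂ : PMF X) (hP₁ : ∀ a, P₁ a ≠ 0) (hP₂ : ∀ a, P₂ a ≠ 0)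
    {p : ℝ} (hp : p ∈ Set.Ioo (0 : ℝ) 1)
    {γ : ℝ} (hγ : γ ∈ Set.Ioc 0 (chernoff (vec P₁) (vec P₂))) {Φ : ∀ N : ℕ, Test X N}
    (hΦ : ∀ N, IsSeqTest γ (Φ N)) : (γ : EReal) ≤ bayesExponent P₁ P₂ p Φ := by
  refine le_of_forall_lt fun c hc => ?_
  obtain ⟨d, hcd, hdγ⟩ := EReal.lt_iff_exists_real_btwn.1 hc
  refine hcd.trans_le (le_liminf_of_le (by isBoundedDefault) ?_)
  have hdγ' : d < γ := by exact_mod_cast hdγ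
  filter_upwards [eventually_errProb_seq_le P₁ P₂ hP₁ hP₂ hγ hΦ .H₁ hdγ',
    eventually_errProb_seq_le P₁ P₂ hP₁ hP₂ hγ hΦ .H₂ hdγ', eventually_ne_atTop 0]
    with N h₁ h₂ hN
  exact le_neg_log_div hN (bayesErr_le P₁ P₂ hp _ fun i => by cases i <;> assumption)

end

section

variable {X : Type*} [Fintype X]

/-! ### Gutman's test -/

lemma continuousAt_gjs {Q₁ Q₂ : X → ℝ} (pos₁ : ∀ a, 0 < Q₁ a) (pos₂ : ∀ a, 0 < Q₂ a) {α : ℝ}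
    (hα : 0 < α) : ContinuousAt (fun T : (X → ℝ) × (X → ℝ) => gjs T.1 T.2 α) (Q₁, Q₂) := by
  have c₁ : ∀ a, ContinuousAt (fun T : (X → ℝ) × (X → ℝ) => T.1 a) (Q₁, Q₂) := fun a => by
    fun_prop
  have c₂ : ∀ a, ContinuousAt (fun T : (X → ℝ) × (X → ℝ) => T.2 a) (Q₁, Q₂) := fun a => by
    fun_prop
  have cm : ∀ a, ContinuousAt (fun T : (X → ℝ) × (X → ℝ) => mix T.1 T.2 α a) (Q₁, Q₂) :=
    fun a => ((continuousAt_const.mul (c₁ a)).add (c₂ a)).div_const _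
  have hm := mix_pos pos₁ pos₂ hα
  have term : ∀ (f : (X → ℝ) × (X → ℝ) → ℝ) (a : X), ContinuousAt f (Q₁, Q₂) →
      0 < f (Q₁, Q₂) →
      ContinuousAt (fun T => f T * Real.log (f T / mix T.1 T.2 α a)) (Q₁, Q₂) :=
    fun f a hf h0 => hf.mul ((hf.div (cm a) (hm a).ne').log (div_pos h0 (hm a)).ne')
  simp only [gjs, kl]
  refine (continuousAt_const.mul ?_).add ?_
  · exact tendsto_finsetSum _ fun a _ => term (fun T => T.1 a) a (c₁ a) (pos₁ a)
  · exact tendsto_finsetSum _ fun a _ => term (fun T => T.2 a) a (c₂ a) (pos₂ a)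

lemma exists_gjs_lt_of_near {Q₁ Q₂ : X → ℝ} (pos₁ : ∀ a, 0 < Q₁ a) (pos₂ : ∀ a, 0 < Q₂ a)
    {α c : ℝ} (hα : 0 < α) (h : gjs Q₁ Q₂ α < c) :
    ∃ δ > 0, ∀ T₁ T₂ : X → ℝ, (∀ a, |T₁ a - Q₁ a| ≤ δ) → (∀ a, |T₂ a - Q₂ a| ≤ δ) →
      gjs T₁ T₂ α < c := by
  obtain ⟨ε, hε, hball⟩ := Metric.eventually_nhds_iff.1
    ((continuousAt_gjs pos₁ pos₂ hα).eventually_lt_const h)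
  refine ⟨ε / 2, half_pos hε, fun T₁ T₂ h₁ h₂ => hball (y := (T₁, T₂)) ?_⟩
  refine lt_of_le_of_lt (max_le ?_ ?_) (half_lt_self hε)
  · exact (dist_pi_le_iff (half_pos hε).le).2 fun a => by rw [Real.dist_eq]; exact h₁ a
  · exact (dist_pi_le_iff (half_pos hε).le).2 fun a => by rw [Real.dist_eq]; exact h₂ a

variable [DecidableEq X] [MeasurableSpace X] [MeasurableSingletonClass X]

lemma bayesExponent_gut_lt_of_pair (P₁ P₂ : PMF X) (hP₁ : ∀ a, P₁ a ≠ 0) (hP₂ : ∀ a, P₂ a ≠ 0)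
    {p : ℝ} (hp : p ∈ Set.Ioo (0 : ℝ) 1) {α lam γ : ℝ} (hα : 0 < α) {n : ℕ → ℕ}
    (hn : Tendsto (fun N : ℕ => (N : ℝ) / n N) atTop (𝓝 α)) {Φ : ∀ N : ℕ, Test X N}
    (hΦ : ∀ N, IsGutmanTest lam α (n N) (Φ N)) {Q₁ Q₂ : X → ℝ} (hQ₁ : Q₁ ∈ stdSimplex ℝ X)
    (hQ₂ : Q₂ ∈ stdSimplex ℝ X) (pos₁ : ∀ a, 0 < Q₁ a) (pos₂ : ∀ a, 0 < Q₂ a)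
    (hg : gjs Q₁ Q₂ α < lam * α) (hk : kl Q₁ (vec P₁) + kl Q₂ (vec P₂) / α < γ) :
    bayesExponent P₁ P₂ p Φ < γ := by
  have hinv : Tendsto (fun N : ℕ => (n N : ℝ) / N) atTop (𝓝 α⁻¹) := by
    simpa using hn.inv₀ hα.ne'
  have hninf : Tendsto n atTop atTop := by
    have h1 : Tendsto (fun N : ℕ => (n N : ℝ) / N * N) atTop atTop :=
      hinv.pos_mul_atTop (inv_pos.2 hα) tendsto_natCast_atTop_atTop
    refine tendsto_natCast_atTop_iff.1 (h1.congr' ?_)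
    filter_upwards [eventually_ne_atTop 0] with N hN
    exact div_mul_cancel₀ _ (by exact_mod_cast hN)
  obtain ⟨δ₀, hδ₀, hnear⟩ := exists_gjs_lt_of_near pos₁ pos₂ hα hg
  set S₁ := ∑ a, |Real.log (Q₁ a / vec P₁ a)|
  set S₂ := ∑ a, |Real.log (Q₂ a / vec P₂ a)|
  -- The strict cost inequality survives the typicality correction for small δ.
  obtain ⟨δ, ⟨hδ, hδδ₀⟩, hcost⟩ : ∃ δ : ℝ, (0 < δ ∧ δ < δ₀) ∧
      kl Q₁ (vec P₁) + δ * S₁ + (kl Q₂ (vec P₂) + δ * S₂) * α⁻¹ < γ := by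
    have hc : Continuous fun δ : ℝ =>
        kl Q₁ (vec P₁) + δ * S₁ + (kl Q₂ (vec P₂) + δ * S₂) * α⁻¹ := by fun_prop
    have h0 : ∀ᶠ δ in 𝓝[>] (0 : ℝ),
        kl Q₁ (vec P₁) + δ * S₁ + (kl Q₂ (vec P₂) + δ * S₂) * α⁻¹ < γ :=
      (hc.continuousAt.eventually_lt_const (by simpa [div_eq_mul_inv] using hk)).filter_mono
        nhdsWithin_le_nhds
    obtain ⟨δ, h1, h2⟩ := (h0.and (Ioo_mem_nhdsGT hδ₀)).exists
    exact ⟨δ, h2, h1⟩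
  set c₁ := kl Q₁ (vec P₁) + δ * S₁ with hc₁
  set c₂ := kl Q₂ (vec P₂) + δ * S₂ with hc₂
  have hlow := eventually_le_pairProb (vec_pos hP₁) (vec_pos hP₂) hQ₁ hQ₂ pos₁ pos₂ hδ hninf
    (fun N x y => gjs (empType x) (empType y) α < lam * α)
    fun N x y hx hy => hnear _ _ (fun a => (hx a).trans hδδ₀.le) fun a => (hy a).trans hδδ₀.le
  have hp1 : 0 < (1 - p) / 4 := by linarith [hp.2]
  obtain ⟨d, hd1, hd2⟩ := exists_between hcost
  have hlim : Tendsto (fun N : ℕ => c₁ + c₂ * ((n N : ℝ) / N) - Real.log ((1 - p) / 4) / N) atTop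
      (𝓝 (c₁ + c₂ * α⁻¹ - 0)) :=
    (tendsto_const_nhds.add (hinv.const_mul c₂)).sub
      (tendsto_const_nhds.div_atTop tendsto_natCast_atTop_atTop)
  rw [sub_zero] at hlim
  have hev : ∀ᶠ N : ℕ in atTop,
      -ENNReal.log (bayesErr P₁ P₂ p (Φ N)) / (N : EReal) ≤ (d : EReal) := by
    filter_upwards [hlow, hlim.eventually_lt_const hd1, eventually_ne_atTop 0] with N h₁ h₂ hN
    have hNpos : (0 : ℝ) < N := by exact_mod_cast Nat.pos_of_ne_zero hN
    refine neg_log_div_le hN ?_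
    have hsub : {s : (Fin N → X) × (Fin N → X) × (ℕ → X) |
        gjs (empType ((toData s).train .H₁)) (empType ((toData s).prefix (n N))) α < lam * α} ⊆
        {s | (Φ N).d (toData s) ≠ .H₂} := fun s hs => by
      have := ((hΦ N) (toData s)).2.1 hs
      simp [this]
    -- Under H₂ the training sequence of class 1 has law `P₁` and the test samples have law `P₂`;
    -- this error alone already bounds the exponent.
    have herr := (law_apply_eq_pairProb P₁ P₂ N (n N) .H₁ .H₂ fun x y =>
      gjs (empType x) (empType y) α < lam * α).symm.trans_le (measure_mono hsub)
    calc ENNReal.ofReal (Real.exp (-(d * N)))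
        ≤ ENNReal.ofReal ((1 - p) * (1 / 4 * Real.exp (-(N * c₁ + n N * c₂)))) := by
          refine ENNReal.ofReal_le_ofReal ?_
          rw [← mul_assoc, mul_one_div, ← Real.exp_log hp1, ← Real.exp_add]
          refine Real.exp_le_exp.2 ?_
          have h3 := mul_le_mul_of_nonneg_right h₂.le hNpos.le
          have h4 : (c₁ + c₂ * ((n N : ℝ) / N) - Real.log ((1 - p) / 4) / N) * N =
              N * c₁ + n N * c₂ - Real.log ((1 - p) / 4) := by
            field_simp
          linarith
      _ = ENNReal.ofReal (1 - p) * ENNReal.ofReal (1 / 4 * Real.exp (-(N * c₁ + n N * c₂))) :=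
          ENNReal.ofReal_mul (by linarith [hp.2])
      _ ≤ ENNReal.ofReal (1 - p) * errProb P₁ P₂ (Φ N) .H₂ := by
          gcongr
          exact (ENNReal.ofReal_le_ofReal h₁).trans herr
      _ ≤ bayesErr P₁ P₂ p (Φ N) := le_add_self
  refine lt_of_le_of_lt (liminf_le_of_frequently_le hev.frequently (by isBoundedDefault)) ?_
  exact_mod_cast hd2

lemma bayesExponent_gut_lt (P₁ P₂ : PMF X) (hP₁ : ∀ a, P₁ a ≠ 0) (hP₂ : ∀ a, P₂ a ≠ 0)
    {p : ℝ} (hp : p ∈ Set.Ioo (0 : ℝ) 1) {α lam γ : ℝ} (hα : 0 < α) (hγ : 0 < γ)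
    (hαγ : gjs (vec P₁) (vec P₂) α = γ * α ∨ gjs (vec P₂) (vec P₁) α = γ * α) {n : ℕ → ℕ}
    (hn : Tendsto (fun N : ℕ => (N : ℝ) / n N) atTop (𝓝 α))
    (hlam : IsOptimalThreshold (vec P₁) (vec P₂) α lam) {Φ : ∀ N : ℕ, Test X N}
    (hΦ : ∀ N, IsGutmanTest lam α (n N) (Φ N)) : bayesExponent P₁ P₂ p Φ < γ := by
  have m₁ := vec_mem P₁
  have m₂ := vec_mem P₂
  -- Equal sources would have zero GJS, whereas `γ * α` is positive.
  have hne : vec P₁ ≠ vec P₂ := fun h => by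
    rw [h, or_self, gjs_self _ hα] at hαγ
    exact (mul_pos hγ hα).ne hαγ
  have hpair : ∃ Q₁ ∈ stdSimplex ℝ X, ∃ Q₂ ∈ stdSimplex ℝ X,
      kl Q₁ (vec P₁) + kl Q₂ (vec P₂) / α + gjs Q₁ Q₂ α / α < γ := by
    rcases hαγ with h | h
    · have := exists_pair_lt_of_gjs m₁ m₂ (vec_pos hP₁) (vec_pos hP₂) hne hα
      rwa [h, mul_div_cancel_right₀ _ hα.ne'] at this
    · have := exists_pair_lt_of_gjs_swap m₁ m₂ (vec_pos hP₁) (vec_pos hP₂) hne hα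
      rwa [h, mul_div_cancel_right₀ _ hα.ne'] at this
  obtain ⟨Q₁, hQ₁, Q₂, hQ₂, q₁, q₂, hg, hk⟩ := exists_pos_pair m₁ m₂ (vec_pos hP₁) (vec_pos hP₂)
    hα (hlam.exists_pair m₁ m₂ (vec_pos hP₁) (vec_pos hP₂) hne hα hpair)
  exact bayesExponent_gut_lt_of_pair P₁ P₂ hP₁ hP₂ hp hα hn hΦ hQ₁ hQ₂ q₁ q₂ hg hk

end

end SeqClass

theorem theorem3 {X : Type*} [Fintype X] [DecidableEq X] [MeasurableSpace X]
    [MeasurableSingletonClass X] (P₁ P₂ : PMF X) (hP₁ : ∀ a, P₁ a ≠ 0) (hP₂ : ∀ a, P₂ a ≠ 0)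
    (p : ℝ) (hp : p ∈ Set.Ioo (0 : ℝ) 1)
    (γ : ℝ) (hγ : γ ∈ Set.Ioc 0 (chernoff (vec P₁) (vec P₂)))
    (β θ : ℝ) (hβ : 0 < β) (hθ : 0 < θ)
    (hβγ : gjs (vec P₂) (vec P₁) β = γ * β) (hθγ : gjs (vec P₁) (vec P₂) θ = γ * θ)
    (n : ℕ → ℕ) (hn : Tendsto (fun N : ℕ => (N : ℝ) / n N) atTop (𝓝 (min θ β)))
    (lam : ℝ) (hlam : IsOptimalThreshold (vec P₁) (vec P₂) (min θ β) lam)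
    (Φseq Φgut : ∀ N : ℕ, Test X N) (hseq : ∀ N, IsSeqTest γ (Φseq N))
    (hgut : ∀ N, IsGutmanTest lam (min θ β) (n N) (Φgut N)) :
    bayesExponent P₁ P₂ p Φgut < (γ : EReal) ∧
      (γ : EReal) ≤ bayesExponent P₁ P₂ p Φseq ∧
      bayesExponent P₁ P₂ p Φgut < bayesExponent P₁ P₂ p Φseq := by
  have hα : 0 < min θ β := lt_min hθ hβ
  have hαγ : gjs (vec P₁) (vec P₂) (min θ β) = γ * min θ β ∨
      gjs (vec P₂) (vec P₁) (min θ β) = γ * min θ β := by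
    rcases min_choice θ β with h | h <;> rw [h]
    · exact Or.inl hθγ
    · exact Or.inr hβγ
  have hgut_lt := bayesExponent_gut_lt P₁ P₂ hP₁ hP₂ hp hα hγ.1 hαγ hn hlam hgut
  have hseq_le := le_bayesExponent_seq P₁ P₂ hP₁ hP₂ hp hγ hseq
  exact ⟨hgut_lt, hseq_le, hgut_lt.trans_le hseq_le⟩
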